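/- Let $\mathcal H$ be a complex Hilbert space with scalar product $\langle\cdot,\cdot\rangle$ antilinear in the first argument, and let $H$ and $A$ be (possibly unbounded) self-adjoint operators in $\mathcal H$ such that $(H-i)^{-1}\in C^1(A)$, i.e. for each $\psi\in\mathcal H$ the map $\mathbb R\ni t\mapsto e^{-itA}(H-i)^{-1}e^{itA}\psi\in\mathcal H$ is of class $C^1$. Let $[iH,A]:\mathrm{dom}(H)\to\mathrm{dom}(H)^*$ be the operator associated with the continuous extension to $\mathrm{dom}(H)$ (with the graph topology) of the form $(\varphi,\psi)\mapsto i\big(\langle H\varphi,A\psi\rangle-\langle A\varphi,H\psi\rangle\big)$ on $\mathrm{dom}(H)\cap\mathrm{dom}(A)$, so that $(H+i)^{-1}[iH,A](H-i)^{-1}$ is a bounded operator on $\mathcal H$. Assume that the strong limit $$D:=\operatorname*{s-lim}_{t\to\infty}\frac1t\int_0^t e^{isH}(H+i)^{-1}[iH,A](H-i)^{-1}e^{-isH}\,ds$$ exists and satisfies $D=g(H)$ for some $g\in C^2(\mathbb R;\mathbb R)\cap L^\infty(\mathbb R)$. Set $\Lambda:=\mathbb R\setminus g^{-1}(\{0\})$.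 Then: (a) $\lim_{t\to\infty}\langle\varphi,e^{-itH}\psi\rangle=0$ for each $\varphi\in\mathcal H$ and $\psi\in\chi_\Lambda(H)\mathcal H$; (b) the closed subspace $\chi_\Lambda(H)\mathcal H$ reduces $H$, and the restriction $H|_{\chi_\Lambda(H)\mathcal H}$ has purely continuous spectrum, i.e. the closed linear span of its eigenvectors is $\{0\}$. -/

import Mathlib

open MeasureTheory Filter Topology
open scoped InnerProductSpace ENNReal

noncomputable section

variable {𝓗 : Type*} [NormedAddCommGroup 𝓗] [InnerProductSpace ℂ 𝓗]

/-- A projection-valued (spectral) measure on the Borel sets of `ℝ`. The values at non-measurable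
sets play no role. -/
structure ProjectionValuedMeasure (𝓗 : Type*) [NormedAddCommGroup 𝓗] [InnerProductSpace ℂ 𝓗]
    [CompleteSpace 𝓗] where
  /-- The projection attached to a Borel set. -/
  proj : Set ℝ → 𝓗 →L[ℂ] 𝓗
  isStarProjection : ∀ B, MeasurableSet B → IsStarProjection (proj B)
  proj_univ : proj Set.univ = 1
  proj_inter : ∀ B C, MeasurableSet B → MeasurableSet C → proj (B ∩ C) = proj B * proj C
  hasSum_proj : ∀ B : ℕ → Set ℝ, (∀ n, MeasurableSet (B n)) → Pairwise (Function.onFun Disjoint B) →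
    ∀ ψ : 𝓗, HasSum (fun n => proj (B n) ψ) (proj (⋃ n, B n) ψ)

namespace ProjectionValuedMeasure

variable [CompleteSpace 𝓗] (E : ProjectionValuedMeasure 𝓗)

theorem inner_proj {B : Set ℝ} (hB : MeasurableSet B) (ψ : 𝓗) :
    (⟪ψ, E.proj B ψ⟫_ℂ).re = ‖E.proj B ψ‖ ^ 2 := by
  have h := E.isStarProjection B hB
  have hsa : ContinuousLinearMap.adjoint (E.proj B) = E.proj B := h.isSelfAdjoint
  have hid : E.proj B (E.proj B ψ) = E.proj B ψ :=
    congrArg (fun T : 𝓗 →L[ℂ] 𝓗 => T ψ) h.isIdempotentElem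
  have e : ⟪ψ, E.proj B ψ⟫_ℂ = ⟪E.proj B ψ, E.proj B ψ⟫_ℂ := by
    rw [← ContinuousLinearMap.adjoint_inner_right, hsa, hid]
  rw [e, inner_self_eq_norm_sq_to_K]
  norm_cast

/-- The scalar spectral measure `B ↦ ⟨ψ, E(B) ψ⟩` of a vector `ψ`. -/
def measure (ψ : 𝓗) : Measure ℝ :=
  Measure.ofMeasurable (fun B _ => ENNReal.ofReal (⟪ψ, E.proj B ψ⟫_ℂ).re)
    (by
      have h := E.hasSum_proj (fun _ => ∅) (fun _ => MeasurableSet.empty)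
        (fun _ _ _ => by simp [Function.onFun]) ψ
      have h0 : E.proj ∅ ψ = 0 := by
        have := h.summable.tendsto_atTop_zero
        simpa using this
      simp [h0])
    (by
      intro f hf hd
      have h := E.hasSum_proj f hf hd ψ
      have h2 : HasSum (fun n => (⟪ψ, E.proj (f n) ψ⟫_ℂ).re) (⟪ψ, E.proj (⋃ n, f n) ψ⟫_ℂ).re :=
        Complex.reCLM.hasSum ((innerSL ℂ ψ).hasSum h)
      rw [← h2.tsum_eq]
      exact ENNReal.ofReal_tsum_of_nonneg
        (fun n => by rw [E.inner_proj (hf n)]; positivity) h2.summable)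

/-- `E` is the spectral measure of the operator `H`, that is `H = ∫ x dE(x)`: the domain of `H`
consists of the `ψ` with `∫ x² d⟨ψ, E(x) ψ⟩ < ∞`, and `⟨ψ, H ψ⟩ = ∫ x d⟨ψ, E(x) ψ⟩` for such `ψ`
(by polarization this fixes `H`). -/
def Represents (H : 𝓗 →ₗ.[ℂ] 𝓗) : Prop :=
  (∀ ψ : 𝓗, ψ ∈ H.domain ↔ Integrable (fun x : ℝ => x ^ 2) (E.measure ψ)) ∧
  ∀ ψ : H.domain, ⟪(ψ : 𝓗), H ψ⟫_ℂ = ∫ x : ℝ, (x : ℂ) ∂(E.measure (ψ : 𝓗))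

/-- The operator `∫ f dE` for a bounded Borel function `f`: the bounded operator `T` with
`⟨ψ, T ψ⟩ = ∫ f(x) d⟨ψ, E(x) ψ⟩` for all `ψ` (unique by polarization). -/
def integral (f : ℝ → ℂ) : 𝓗 →L[ℂ] 𝓗 :=
  Classical.epsilon fun T : 𝓗 →L[ℂ] 𝓗 => ∀ ψ : 𝓗, ⟪ψ, T ψ⟫_ℂ = ∫ x : ℝ, f x ∂(E.measure ψ)

open Classical in
/-- The point mass at `0`, the spectral measure of the zero operator. -/
def pointMass (𝓗 : Type*) [NormedAddCommGroup 𝓗] [InnerProductSpace ℂ 𝓗] [CompleteSpace 𝓗] :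
    ProjectionValuedMeasure 𝓗 where
  proj B := if (0 : ℝ) ∈ B then 1 else 0
  isStarProjection B _ := by
    split_ifs
    · exact IsStarProjection.one _
    · exact IsStarProjection.zero _
  proj_univ := by simp
  proj_inter B C _ _ := by
    by_cases h1 : (0 : ℝ) ∈ B <;> by_cases h2 : (0 : ℝ) ∈ C <;> simp [h1, h2]
  hasSum_proj B _ hd ψ := by
    by_cases h : ∃ n, (0 : ℝ) ∈ B n
    · obtain ⟨n, hn⟩ := h
      have hU : (0 : ℝ) ∈ ⋃ n, B n := Set.mem_iUnion.2 ⟨n, hn⟩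
      have key : ∀ m, m ≠ n → (0 : ℝ) ∉ B m := fun m hm hm0 =>
        Set.disjoint_left.1 (hd hm) hm0 hn
      have hs := hasSum_single (f := fun m => (if (0 : ℝ) ∈ B m then (1 : 𝓗 →L[ℂ] 𝓗) else 0) ψ) n
        (fun m hm => by simp [key m hm])
      simpa only [hn, hU, if_true] using hs
    · push Not at h
      have hU : (0 : ℝ) ∉ ⋃ n, B n := by simpa using h
      simp [h]

instance : Nonempty (ProjectionValuedMeasure 𝓗) := ⟨pointMass 𝓗⟩

end ProjectionValuedMeasure

namespace LinearPMap

/-- The spectral measure of a self-adjoint operator `H` (the projection-valued measure that the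
spectral theorem attaches to `H`). -/
def spectralMeasure [CompleteSpace 𝓗] (H : 𝓗 →ₗ.[ℂ] 𝓗) : ProjectionValuedMeasure 𝓗 :=
  Classical.epsilon fun E : ProjectionValuedMeasure 𝓗 => E.Represents H

/-- The operator `f(H)` of the bounded Borel functional calculus of a self-adjoint `H`. -/
def borelCalculus [CompleteSpace 𝓗] (H : 𝓗 →ₗ.[ℂ] 𝓗) (f : ℝ → ℂ) : 𝓗 →L[ℂ] 𝓗 :=
  H.spectralMeasure.integral f

/-- The unitary operator `e^{itH}`. -/
def expI [CompleteSpace 𝓗] (H : 𝓗 →ₗ.[ℂ] 𝓗) (t : ℝ) : 𝓗 →L[ℂ] 𝓗 :=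
  H.borelCalculus fun x => Complex.exp (Complex.I * t * x)

/-- The spectral projection `χ_S(H)` onto a Borel set `S`. -/
def spectralProjection [CompleteSpace 𝓗] (H : 𝓗 →ₗ.[ℂ] 𝓗) (S : Set ℝ) : 𝓗 →L[ℂ] 𝓗 :=
  H.borelCalculus (S.indicator fun _ => 1)

/-- The resolvent `(H - z)⁻¹`: the bounded two-sided inverse of `H - z`. -/
def resolventAt (H : 𝓗 →ₗ.[ℂ] 𝓗) (z : ℂ) : 𝓗 →L[ℂ] 𝓗 :=
  Classical.epsilon fun R : 𝓗 →L[ℂ] 𝓗 =>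
    (∀ ψ : 𝓗, ∃ h : R ψ ∈ H.domain, H ⟨R ψ, h⟩ - z • R ψ = ψ) ∧
    ∀ ψ : H.domain, R (H ψ - z • (ψ : 𝓗)) = ψ

/-- The class `C^k(A)`: the map `t ↦ e^{-itA} S e^{itA}` is strongly of class `C^k`. -/
def IsOfClass [CompleteSpace 𝓗] (A : 𝓗 →ₗ.[ℂ] 𝓗) (k : ℕ) (S : 𝓗 →L[ℂ] 𝓗) : Prop :=
  ∀ ψ : 𝓗, ContDiff ℝ k fun t : ℝ => A.expI (-t) (S (A.expI t ψ))

/-- The quadratic (sesquilinear) form of the commutator `[iH, A]` on `dom(H) ∩ dom(A)`: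
`(φ, ψ) ↦ i (⟨Hφ, Aψ⟩ - ⟨Aφ, Hψ⟩)`. -/
def commutatorForm (H A : 𝓗 →ₗ.[ℂ] 𝓗) (φ ψ : ↥(H.domain ⊓ A.domain)) : ℂ :=
  Complex.I * (⟪H ⟨φ, φ.2.1⟩, A ⟨ψ, ψ.2.2⟩⟫_ℂ - ⟪A ⟨φ, φ.2.2⟩, H ⟨ψ, ψ.2.1⟩⟫_ℂ)

/-- The bounded operator `(H + i)⁻¹ [iH, A] (H - i)⁻¹`, where `[iH, A] : dom(H) → dom(H)*` is the
continuous extension to `dom(H)` of the commutator form on `dom(H) ∩ dom(A)`. Since `(H + i)⁻¹` is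
the adjoint of `(H - i)⁻¹`, it is the bounded `B` such that `⟨(H - i)φ, B (H - i)ψ⟩` is the value
of the form `[iH, A]` at `(φ, ψ)`, for `φ, ψ ∈ dom(H) ∩ dom(A)`. If `(H - i)⁻¹ ∈ C^1(A)`, then
`dom(H) ∩ dom(A)` is a core for `H` on which the form is bounded in the graph norm, so there is
exactly one such `B`. -/
def sandwichedCommutator (H A : 𝓗 →ₗ.[ℂ] 𝓗) : 𝓗 →L[ℂ] 𝓗 :=
  Classical.epsilon fun B : 𝓗 →L[ℂ] 𝓗 => ∀ φ ψ : ↥(H.domain ⊓ A.domain),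
    ⟪H ⟨φ, φ.2.1⟩ - Complex.I • (φ : 𝓗), B (H ⟨ψ, ψ.2.1⟩ - Complex.I • (ψ : 𝓗))⟫_ℂ =
      commutatorForm H A φ ψ

/-- `(1/t) ∫₀ᵗ e^{isH} B e^{-isH} ψ ds`, the time average of a bounded operator `B` along the flow
of `H`, applied to the vector `ψ`. -/
def timeAverage [CompleteSpace 𝓗] (H : 𝓗 →ₗ.[ℂ] 𝓗) (B : 𝓗 →L[ℂ] 𝓗) (t : ℝ) (ψ : 𝓗) : 𝓗 :=
  t⁻¹ • ∫ s in (0 : ℝ)..t, H.expI s (B (H.expI (-s) ψ))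

/-- The closed subspace `K` reduces the operator `T`: the decomposition `𝓗 = K ⊕ Kᗮ` decomposes
the domain of `T`, and `T` maps each part into the same summand. -/
def IsReducedBy (T : 𝓗 →ₗ.[ℂ] 𝓗) (K : Submodule ℂ 𝓗) : Prop :=
  _root_.IsClosed (K : Set 𝓗) ∧
  ∀ x : T.domain, ∃ y z : T.domain, (x : 𝓗) = y + z ∧
    (y : 𝓗) ∈ K ∧ (z : 𝓗) ∈ Kᗮ ∧ T y ∈ K ∧ T z ∈ Kᗮ

/-- The restriction (part) of the operator `T` to the subspace `K`. If `K` reduces `T`, its domain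
is `K ∩ dom(T)`. -/
def partIn (T : 𝓗 →ₗ.[ℂ] 𝓗) (K : Submodule ℂ 𝓗) : K →ₗ.[ℂ] K where
  domain :=
    { carrier := {x | ∃ h : (x : 𝓗) ∈ T.domain, T ⟨x, h⟩ ∈ K}
      zero_mem' := ⟨T.domain.zero_mem, by
        have : T ⟨((0 : K) : 𝓗), T.domain.zero_mem⟩ = 0 := T.map_zero
        rw [this]; exact K.zero_mem⟩
      add_mem' := by
        rintro x y ⟨hx, hx'⟩ ⟨hy, hy'⟩
        exact ⟨T.domain.add_mem hx hy, by
          have : T ⟨((x + y : K) : 𝓗), T.domain.add_mem hx hy⟩ = T ⟨x, hx⟩ + T ⟨y, hy⟩ :=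
            T.map_add ⟨x, hx⟩ ⟨y, hy⟩
          rw [this]; exact K.add_mem hx' hy'⟩
      smul_mem' := by
        rintro c x ⟨hx, hx'⟩
        exact ⟨T.domain.smul_mem c hx, by
          have : T ⟨((c • x : K) : 𝓗), T.domain.smul_mem c hx⟩ = c • T ⟨x, hx⟩ :=
            T.map_smul c ⟨x, hx⟩
          rw [this]; exact K.smul_mem c hx'⟩ }
  toFun :=
    { toFun := fun x => ⟨T ⟨x.1, x.2.choose⟩, x.2.choose_spec⟩
      map_add' := fun x y => Subtype.ext (T.map_add ⟨x.1, x.2.choose⟩ ⟨y.1, y.2.choose⟩)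
      map_smul' := fun c x => Subtype.ext (T.map_smul c ⟨x.1, x.2.choose⟩) }

/-- The pure point subspace of `T`: the closed linear span of the eigenvectors of `T`. -/
def pointSubspace (T : 𝓗 →ₗ.[ℂ] 𝓗) : Submodule ℂ 𝓗 :=
  (Submodule.span ℂ {x : 𝓗 | ∃ (h : x ∈ T.domain) (a : ℂ), T ⟨x, h⟩ = a • x}).topologicalClosure

/-- A (self-adjoint) operator has purely continuous spectrum if its pure point subspace is
trivial. -/
def HasPurelyContinuousSpectrum (T : 𝓗 →ₗ.[ℂ] 𝓗) : Prop :=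
  T.pointSubspace = ⊥

end LinearPMap

end

/-! Put R = (H - i)⁻¹, B = R*[iH,A]R and D_t = t⁻¹ ∫₀ᵗ e^{isH} B e^{-isH} ds. For φ, ψ in dom(A),
the vectors Rφ and Rψ again lie in dom(A), because R is of class C¹(A). Formally, ⟨e^{i(t-s)H}φ, B
e^{-isH}ψ⟩ is the s-derivative of ⟨e^{i(t-s)H}Rφ, A e^{-isH}Rψ⟩. Integrating over [0,t] leaves
boundary terms in which A can be moved onto Rφ or Rψ, so ⟨e^{itH}φ, t D_t ψ⟩ is bounded uniformly in
t (`exists_norm_inner_integral_le`). To make this rigorous, A is replaced by the bounded quotients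
(e^{iτA} - 1)/(iτ), and τ → 0 is taken at the end.

Hence ⟨φ, e^{-itH}Dψ⟩ = ⟨e^{itH}φ, (D - D_t)ψ⟩ + O(1/t) tends to 0. By density this extends to every
φ and to the closure of the range of D (`tendsto_inner_expI_of_mem_closure_range`). As D = g(H),
that closure contains χ_Λ(H)𝓗, since 1/g can be truncated near the zeros of g
(`spectralProjection_apply_mem_closure_range`). An eigenvector x in this subspace has |⟨x,
e^{-itH}x⟩| = ‖x‖² for all t, so it vanishes.

The functional calculus is defined by choosing a spectral measure, so the spectral theorem is proved
as well (`exists_represents`). R is normal; its continuous calculus, with Riesz–Markov, gives scalar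
measures on the spectrum of R; these extend to a bounded Borel calculus and are pushed to ℝ by z ↦
Re(1/z). `opIntegral_sub_I_inv` then identifies (x - i)⁻¹ in the chosen calculus with R. -/

/-! ### Bounded measurable functions. -/

/-- A bounded measurable complex function. -/
structure BddMeas {X : Type*} [MeasurableSpace X] (f : X → ℂ) : Prop where
  measurable : Measurable f
  bounded : ∃ C : ℝ, ∀ x, ‖f x‖ ≤ C

namespace BddMeas

variable {X : Type*} [MeasurableSpace X] {f g : X → ℂ}

theorem const (c : ℂ) : BddMeas fun _ : X => c := ⟨measurable_const, ‖c‖, fun _ => le_rfl⟩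

theorem add (hf : BddMeas f) (hg : BddMeas g) : BddMeas fun x => f x + g x := by
  obtain ⟨C, hC⟩ := hf.bounded
  obtain ⟨C', hC'⟩ := hg.bounded
  exact ⟨hf.measurable.add hg.measurable, C + C',
    fun x => (norm_add_le _ _).trans (add_le_add (hC x) (hC' x))⟩

theorem mul (hf : BddMeas f) (hg : BddMeas g) : BddMeas fun x => f x * g x := by
  obtain ⟨C, hC⟩ := hf.bounded
  obtain ⟨C', hC'⟩ := hg.bounded
  refine ⟨hf.measurable.mul hg.measurable, C * C', fun x => ?_⟩
  rw [norm_mul]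
  exact mul_le_mul (hC x) (hC' x) (norm_nonneg _) ((norm_nonneg _).trans (hC x))

theorem const_mul (c : ℂ) (hf : BddMeas f) : BddMeas fun x => c * f x := (const c).mul hf

theorem neg (hf : BddMeas f) : BddMeas fun x => -f x := by
  simpa using hf.const_mul (-1)

theorem sub (hf : BddMeas f) (hg : BddMeas g) : BddMeas fun x => f x - g x := by
  simpa [sub_eq_add_neg] using hf.add hg.neg

theorem conj (hf : BddMeas f) : BddMeas fun x => star (f x) := by
  obtain ⟨C, hC⟩ := hf.bounded
  exact ⟨Complex.continuous_conj.measurable.comp hf.measurable, C, fun x => by simpa using hC x⟩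

theorem indicator_one {s : Set X} (hs : MeasurableSet s) :
    BddMeas (s.indicator fun _ => (1 : ℂ)) := by
  refine ⟨measurable_const.indicator hs, 1, fun x => ?_⟩
  by_cases h : x ∈ s <;> simp [h]

theorem simpleFunc (f : SimpleFunc X ℂ) : BddMeas f :=
  ⟨f.measurable, f.exists_forall_norm_le⟩

theorem integrable (hf : BddMeas f) (ν : Measure X) [IsFiniteMeasure ν] : Integrable f ν := by
  obtain ⟨C, hC⟩ := hf.bounded
  exact Integrable.of_bound hf.measurable.aestronglyMeasurable C (ae_of_all _ hC)

theorem tendsto_integral {ι : Type*} {l : Filter ι} [l.IsCountablyGenerated] {F : ι → X → ℂ}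
    (hF : ∀ i, BddMeas (F i)) {C : ℝ} (hC : ∀ i x, ‖F i x‖ ≤ C) (ν : Measure X)
    [IsFiniteMeasure ν] (h : ∀ x, Tendsto (fun i => F i x) l (𝓝 (f x))) :
    Tendsto (fun i => ∫ x, F i x ∂ν) l (𝓝 (∫ x, f x ∂ν)) :=
  tendsto_integral_filter_of_dominated_convergence (fun _ => C)
    (Eventually.of_forall fun i => (hF i).measurable.aestronglyMeasurable)
    (Eventually.of_forall fun i => ae_of_all _ (hC i)) (integrable_const C) (ae_of_all _ h)

end BddMeas

/-! ### Generating the bounded measurable functions by bounded limits. -/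

/-- A class of functions generates the bounded measurable functions if these are obtained from it
by linear combinations and bounded pointwise sequential limits. -/
def GeneratesBddMeas {X : Type*} [MeasurableSpace X] (𝒞 : Set (X → ℂ)) : Prop :=
  ∀ P : (X → ℂ) → Prop, (∀ f ∈ 𝒞, P f) →
    (∀ f g, BddMeas f → BddMeas g → P f → P g → P fun x => f x + g x) →
    (∀ c f, BddMeas f → P f → P fun x => c * f x) →
    (∀ (F : ℕ → X → ℂ) (f : X → ℂ) (C : ℝ), (∀ n, BddMeas (F n)) → BddMeas f →
      (∀ n x, ‖F n x‖ ≤ C) → (∀ x, Tendsto (fun n => F n x) atTop (𝓝 (f x))) →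
      (∀ n, P (F n)) → P f) →
    ∀ f, BddMeas f → P f

theorem generatesBddMeas_indicator {X : Type*} [MeasurableSpace X] :
    GeneratesBddMeas {f : X → ℂ | ∃ s, MeasurableSet s ∧ f = s.indicator fun _ => 1} := by
  intro P h1 hadd hsmul hlim f hf
  obtain ⟨C, hC⟩ := hf.bounded
  have hsm : StronglyMeasurable f := hf.measurable.stronglyMeasurable
  have hsimple : ∀ s : SimpleFunc X ℂ, P s := by
    intro s
    induction s using SimpleFunc.induction with
    | @const c s hs =>
      have := hsmul c _ (BddMeas.indicator_one hs) (h1 _ ⟨s, hs, rfl⟩)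
      convert this using 1
      ext x
      by_cases hx : x ∈ s <;> simp [hx]
    | @add f g _ hf hg => exact hadd f g (.simpleFunc f) (.simpleFunc g) hf hg
  -- A point of `X` is needed to know `0 ≤ C`, which the truncated simple approximation requires.
  rcases isEmpty_or_nonempty X with hX | hX
  · have : f = fun x => (0 : ℂ) * (∅ : Set X).indicator (fun _ => (1 : ℂ)) x := by
      ext x; exact hX.elim x
    rw [this]
    exact hsmul 0 _ (BddMeas.indicator_one MeasurableSet.empty) (h1 _ ⟨∅, MeasurableSet.empty, rfl⟩)
  have hC0 : 0 ≤ C := (norm_nonneg _).trans (hC hX.some)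
  exact hlim (fun n => hsm.approxBounded C n) f C (fun n => .simpleFunc _) hf
    (fun n x => hsm.norm_approxBounded_le hC0 n x)
    (fun x => hsm.tendsto_approxBounded_of_norm_le (hC x)) fun n => hsimple _

/-- Indicators of closed sets are pointwise limits of continuous functions with values in [0,1].
Closed sets form a π-system generating the Borel sets, so the π-λ theorem reaches all indicators. -/
theorem generatesBddMeas_continuous {X : Type*} [TopologicalSpace X] [MeasurableSpace X]
    [BorelSpace X] [HasOuterApproxClosed X] :
    GeneratesBddMeas {f : X → ℂ | Continuous f ∧ ∃ C : ℝ, ∀ x, ‖f x‖ ≤ C} := by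
  intro P h1 hadd hsmul hlim
  have hone : P fun _ => 1 := h1 _ ⟨continuous_const, 1, by simp⟩
  refine generatesBddMeas_indicator P ?_ hadd hsmul hlim
  rintro _ ⟨s, hs, rfl⟩
  induction s, hs using MeasurableSpace.induction_on_inter
    ((BorelSpace.measurable_eq (α := X)).trans borel_eq_generateFrom_isClosed)
    isPiSystem_isClosed with
  | empty =>
    have := hsmul 0 _ (.const 1) hone
    simpa using this
  | basic t ht =>
    have ht : IsClosed t := ht
    refine hlim (fun n x => ((ht.apprSeq n x : NNReal) : ℝ)) _ 1 (fun n => ⟨?_, 1, ?_⟩)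
      (BddMeas.indicator_one ht.measurableSet) ?_ ?_ ?_
    · exact (Complex.continuous_ofReal.comp
        (NNReal.continuous_coe.comp (ht.apprSeq n).continuous)).measurable
    · intro x
      simpa using HasOuterApproxClosed.apprSeq_apply_le_one ht n x
    · intro n x
      simpa using HasOuterApproxClosed.apprSeq_apply_le_one ht n x
    · intro x
      have h := (tendsto_pi_nhds.1 (HasOuterApproxClosed.tendsto_apprSeq ht)) x
      have h2 : Tendsto (fun n => (((ht.apprSeq n x : NNReal) : ℝ) : ℂ)) atTop
          (𝓝 (((t.indicator (fun _ => (1 : NNReal)) x : NNReal) : ℝ) : ℂ)) :=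
        (Complex.continuous_ofReal.comp NNReal.continuous_coe).continuousAt.tendsto.comp h
      convert h2 using 2
      by_cases hx : x ∈ t <;> simp [hx]
    · intro n
      refine h1 _ ⟨Complex.continuous_ofReal.comp
        (NNReal.continuous_coe.comp (ht.apprSeq n).continuous), 1, fun x => ?_⟩
      simpa using HasOuterApproxClosed.apprSeq_apply_le_one ht n x
  | compl t ht ih =>
    have := hadd _ _ (.const 1) ((BddMeas.indicator_one ht).const_mul (-1)) hone
      (hsmul (-1) _ (.indicator_one ht) ih)
    convert this using 1
    ext x
    by_cases hx : x ∈ t <;> simp [hx]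
  | iUnion f hd hf ih =>
    have hfin : ∀ n : ℕ, MeasurableSet (⋃ i ∈ Finset.range n, f i) := fun n =>
      Finset.measurableSet_biUnion _ fun i _ => hf i
    refine hlim (fun n => (⋃ i ∈ Finset.range n, f i).indicator fun _ => 1) _ 1
      (fun n => .indicator_one (hfin n)) (.indicator_one (.iUnion hf)) ?_ ?_ ?_
    · intro n x
      by_cases hx : x ∈ ⋃ i ∈ Finset.range n, f i <;> simp only [hx, Set.indicator_of_mem,
        Set.indicator_of_notMem, not_false_eq_true] <;> simp
    · intro x
      by_cases hx : x ∈ ⋃ i, f i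
      · obtain ⟨i, hi⟩ := Set.mem_iUnion.1 hx
        refine tendsto_const_nhds.congr' ?_
        filter_upwards [eventually_gt_atTop i] with n hn
        rw [Set.indicator_of_mem hx, Set.indicator_of_mem]
        exact Set.mem_biUnion (Finset.mem_coe.2 (Finset.mem_range.2 hn)) hi
      · refine tendsto_const_nhds.congr fun n => ?_
        rw [Set.indicator_of_notMem hx, Set.indicator_of_notMem]
        intro h
        obtain ⟨i, _, hi⟩ := Set.mem_iUnion₂.1 h
        exact hx (Set.mem_iUnion.2 ⟨i, hi⟩)
    · intro n
      induction n with
      | zero =>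
        have := hsmul 0 _ (.const 1) hone
        simpa using this
      | succ n hn =>
        have := hadd _ _ (.indicator_one (hfin n)) (.indicator_one (hf n)) hn (ih n)
        convert this using 1
        have hdis : Disjoint (⋃ i ∈ Finset.range n, f i) (f n) := by
          refine Set.disjoint_iUnion₂_left.2 fun i hi => hd (Finset.mem_range.1 hi).ne
        have hU : (⋃ i ∈ Finset.range (n + 1), f i) = (⋃ i ∈ Finset.range n, f i) ∪ f n := by
          rw [Finset.range_add_one, Finset.set_biUnion_insert, Set.union_comm]
        rw [hU, Set.indicator_union_of_disjoint hdis]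

/-! ### Operators obtained by polarizing families of scalar measures. -/

section Families

variable {𝓗 : Type*} [NormedAddCommGroup 𝓗] [InnerProductSpace ℂ 𝓗]
  {X : Type*} [MeasurableSpace X]

/-- The operator `T` is the integral of `f` with respect to the family of scalar measures `μ`. -/
def IsIntegralOf (μ : 𝓗 → Measure X) (f : X → ℂ) (T : 𝓗 →L[ℂ] 𝓗) : Prop :=
  ∀ ψ, ⟪ψ, T ψ⟫_ℂ = ∫ x, f x ∂(μ ψ)

/-- The sesquilinear form obtained by polarizing `ψ ↦ ∫ f dμ_ψ`. -/
noncomputable def polarForm (μ : 𝓗 → Measure X) (f : X → ℂ) (φ ψ : 𝓗) : ℂ :=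
  ((∫ x, f x ∂(μ (φ + ψ))) - (∫ x, f x ∂(μ (φ - ψ)))
    - Complex.I * (∫ x, f x ∂(μ (φ + Complex.I • ψ)))
    + Complex.I * (∫ x, f x ∂(μ (φ - Complex.I • ψ)))) / 4

/-- Complex polarization: the quadratic form determines the operator, which gives uniqueness
throughout. -/
theorem IsIntegralOf.inner {μ : 𝓗 → Measure X} {f : X → ℂ} {T : 𝓗 →L[ℂ] 𝓗}
    (h : IsIntegralOf μ f T) (φ ψ : 𝓗) : ⟪φ, T ψ⟫_ℂ = polarForm μ f φ ψ := by
  simp only [polarForm, ← h _, map_add, map_sub, map_smul, inner_add_left, inner_add_right,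
    inner_sub_left, inner_sub_right, inner_smul_left, inner_smul_right, Complex.conj_I]
  ring_nf
  simp only [Complex.I_sq]
  ring

/-- A family of measures with total masses `‖ψ‖²`. -/
def HasNormSqMass (μ : 𝓗 → Measure X) : Prop := ∀ ψ, μ ψ Set.univ = ENNReal.ofReal (‖ψ‖ ^ 2)

variable {μ : 𝓗 → Measure X}

theorem HasNormSqMass.isFiniteMeasure (hμ : HasNormSqMass μ) (ψ : 𝓗) : IsFiniteMeasure (μ ψ) :=
  ⟨by rw [hμ]; exact ENNReal.ofReal_lt_top⟩

theorem HasNormSqMass.real (hμ : HasNormSqMass μ) (ψ : 𝓗) : (μ ψ).real Set.univ = ‖ψ‖ ^ 2 := by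
  rw [Measure.real, hμ, ENNReal.toReal_ofReal (by positivity)]

theorem polarForm_add (hμ : HasNormSqMass μ) {f g : X → ℂ} (hf : BddMeas f) (hg : BddMeas g)
    (φ ψ : 𝓗) :
    polarForm μ (fun x => f x + g x) φ ψ = polarForm μ f φ ψ + polarForm μ g φ ψ := by
  have := hμ.isFiniteMeasure
  simp only [polarForm, integral_add (hf.integrable _) (hg.integrable _)]
  ring

theorem polarForm_const_mul (c : ℂ) (f : X → ℂ) (φ ψ : 𝓗) :
    polarForm μ (fun x => c * f x) φ ψ = c * polarForm μ f φ ψ := by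
  simp only [polarForm, integral_const_mul]
  ring

theorem tendsto_polarForm (hμ : HasNormSqMass μ) {ι : Type*} {l : Filter ι}
    [l.IsCountablyGenerated] {F : ι → X → ℂ} {f : X → ℂ} (hF : ∀ i, BddMeas (F i)) {C : ℝ}
    (hC : ∀ i x, ‖F i x‖ ≤ C) (h : ∀ x, Tendsto (fun i => F i x) l (𝓝 (f x))) (φ ψ : 𝓗) :
    Tendsto (fun i => polarForm μ (F i) φ ψ) l (𝓝 (polarForm μ f φ ψ)) := by
  have := hμ.isFiniteMeasure
  have key := fun χ : 𝓗 => BddMeas.tendsto_integral hF hC (μ χ) h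
  exact ((((key _).sub (key _)).sub ((key _).const_mul _)).add ((key _).const_mul _)).div_const 4

theorem norm_integral_le_of_hasNormSqMass (hμ : HasNormSqMass μ) {f : X → ℂ} {C : ℝ}
    (hC : ∀ x, ‖f x‖ ≤ C) (ψ : 𝓗) : ‖∫ x, f x ∂(μ ψ)‖ ≤ C * ‖ψ‖ ^ 2 := by
  have := hμ.isFiniteMeasure ψ
  rw [← hμ.real]
  exact norm_integral_le_of_norm_le_const (ae_of_all _ hC)

/-- The parallelogram law for (φ, ψ) and for (φ, iψ) sums the four polarization terms to exactly
four times the bound. -/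
theorem norm_polarForm_le (hμ : HasNormSqMass μ) {f : X → ℂ} {C : ℝ}
    (hC : ∀ x, ‖f x‖ ≤ C) (φ ψ : 𝓗) :
    ‖polarForm μ f φ ψ‖ ≤ C * (‖φ‖ ^ 2 + ‖ψ‖ ^ 2) := by
  have key := norm_integral_le_of_hasNormSqMass hμ hC
  have p1 := parallelogram_law_with_norm ℂ φ ψ
  have p2 := parallelogram_law_with_norm ℂ φ (Complex.I • ψ)
  rw [norm_smul, Complex.norm_I, one_mul] at p2
  rw [polarForm, norm_div]
  have h4 : ‖(4 : ℂ)‖ = 4 := by norm_num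
  rw [h4, div_le_iff₀ (by norm_num)]
  refine (norm_add_le _ _).trans ?_
  refine (add_le_add_left (norm_sub_le _ _) _).trans ?_
  refine (add_le_add_left (add_le_add_left (norm_sub_le _ _) _) _).trans ?_
  rw [norm_mul, norm_mul, Complex.norm_I, one_mul, one_mul]
  have := key (φ + ψ)
  have := key (φ - ψ)
  have := key (φ + Complex.I • ψ)
  have := key (φ - Complex.I • ψ)
  have e1 : C * (‖φ + ψ‖ ^ 2) + C * ‖φ - ψ‖ ^ 2 = C * (2 * (‖φ‖ ^ 2 + ‖ψ‖ ^ 2)) := by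
    linear_combination C * p1
  have e2 : C * (‖φ + Complex.I • ψ‖ ^ 2) + C * ‖φ - Complex.I • ψ‖ ^ 2
      = C * (2 * (‖φ‖ ^ 2 + ‖ψ‖ ^ 2)) := by
    linear_combination C * p2
  linarith

variable [CompleteSpace 𝓗]

/-- Sesquilinearity of the polarized form is an identity preserved by linear combinations and
bounded limits, so it passes from the generating class to all bounded measurable functions. Riesz
representation then supplies the operator. -/
theorem exists_isIntegralOf (hμ : HasNormSqMass μ) {𝒞 : Set (X → ℂ)} (h𝒞 : GeneratesBddMeas 𝒞)
    (h : ∀ f ∈ 𝒞, ∃ T, IsIntegralOf μ f T) {f : X → ℂ} (hf : BddMeas f) :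
    ∃ T, IsIntegralOf μ f T := by
  have lin : (∀ a b c, polarForm μ f (a + b) c = polarForm μ f a c + polarForm μ f b c) ∧
      (∀ (k : ℂ) a c, polarForm μ f (k • a) c = starRingEnd ℂ k * polarForm μ f a c) ∧
      (∀ a b c, polarForm μ f a (b + c) = polarForm μ f a b + polarForm μ f a c) ∧
      (∀ (k : ℂ) a c, polarForm μ f a (k • c) = k * polarForm μ f a c) ∧
      ∀ a, polarForm μ f a a = ∫ x, f x ∂(μ a) := by
    refine h𝒞 (fun f => (∀ a b c, polarForm μ f (a + b) c = polarForm μ f a c + polarForm μ f b c)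
      ∧ (∀ (k : ℂ) a c, polarForm μ f (k • a) c = starRingEnd ℂ k * polarForm μ f a c) ∧
      (∀ a b c, polarForm μ f a (b + c) = polarForm μ f a b + polarForm μ f a c) ∧
      (∀ (k : ℂ) a c, polarForm μ f a (k • c) = k * polarForm μ f a c) ∧
      ∀ a, polarForm μ f a a = ∫ x, f x ∂(μ a)) ?_ ?_ ?_ ?_ f hf
    · intro f hf
      obtain ⟨T, hT⟩ := h f hf
      simp only [← hT.inner, ← hT _]
      refine ⟨?_, ?_, ?_, ?_, ?_⟩ <;> intros <;>
        simp [inner_add_left, inner_add_right, inner_smul_left, inner_smul_right, mul_comm]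
    · rintro f g hf hg ⟨f1, f2, f3, f4, f5⟩ ⟨g1, g2, g3, g4, g5⟩
      have := hμ.isFiniteMeasure
      simp only [polarForm_add hμ hf hg, integral_add (hf.integrable _) (hg.integrable _)]
      refine ⟨fun a b c => ?_, fun k a c => ?_, fun a b c => ?_, fun k a c => ?_, fun a => ?_⟩
      · rw [f1, g1]; ring
      · rw [f2, g2]; ring
      · rw [f3, g3]; ring
      · rw [f4, g4]; ring
      · rw [f5, g5]
    · rintro c f hf ⟨f1, f2, f3, f4, f5⟩
      simp only [polarForm_const_mul, integral_const_mul]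
      refine ⟨fun a b c => ?_, fun k a c => ?_, fun a b c => ?_, fun k a c => ?_, fun a => ?_⟩
      · rw [f1]; ring
      · rw [f2]; ring
      · rw [f3]; ring
      · rw [f4]; ring
      · rw [f5]
    · intro F f C hF hf hC hlim hP
      have := hμ.isFiniteMeasure
      have key := tendsto_polarForm hμ hF hC hlim
      refine ⟨fun a b c => ?_, fun k a c => ?_, fun a b c => ?_, fun k a c => ?_, fun a => ?_⟩
      · refine tendsto_nhds_unique (key _ _) (((key _ _).add (key _ _)).congr fun n => ?_)
        rw [(hP n).1]
      · refine tendsto_nhds_unique (key _ _) (((key _ _).const_mul _).congr fun n => ?_)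
        rw [(hP n).2.1]
      · refine tendsto_nhds_unique (key _ _) (((key _ _).add (key _ _)).congr fun n => ?_)
        rw [(hP n).2.2.1]
      · refine tendsto_nhds_unique (key _ _) (((key _ _).const_mul _).congr fun n => ?_)
        rw [(hP n).2.2.2.1]
      · refine tendsto_nhds_unique (key _ _)
          ((BddMeas.tendsto_integral hF hC (μ a) hlim).congr fun n => ?_)
        rw [(hP n).2.2.2.2]
  obtain ⟨l1, l2, l3, l4, l5⟩ := lin
  obtain ⟨C, hC⟩ := hf.bounded
  let B : 𝓗 →ₗ⋆[ℂ] 𝓗 →ₗ[ℂ] ℂ := LinearMap.mk₂'ₛₗ (starRingEnd ℂ) (RingHom.id ℂ) (polarForm μ f)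
    l1 l2 l3 l4
  have hB : ∀ a b, ‖B a b‖ ≤ (2 * C) * ‖a‖ * ‖b‖ := by
    intro a b
    by_cases ha : a = 0
    · subst ha; simp
    by_cases hb : b = 0
    · subst hb; simp
    have ha' : ‖a‖ ≠ 0 := norm_ne_zero_iff.2 ha
    have hb' : ‖b‖ ≠ 0 := norm_ne_zero_iff.2 hb
    -- Rescaling to unit vectors turns the bound by a sum of squares into a product bound, whence
    -- the constant 2C.
    have h1 := norm_polarForm_le hμ hC (((‖a‖⁻¹ : ℝ) : ℂ) • a) (((‖b‖⁻¹ : ℝ) : ℂ) • b)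
    rw [l2, l4, norm_mul, norm_mul, norm_smul, norm_smul] at h1
    simp only [Complex.ofReal_inv, map_inv₀, Complex.conj_ofReal, norm_inv, Complex.norm_real,
      norm_norm, inv_mul_cancel₀ ha', inv_mul_cancel₀ hb'] at h1
    change ‖polarForm μ f a b‖ ≤ _
    have h2 := mul_le_mul_of_nonneg_left h1 (by positivity : (0 : ℝ) ≤ ‖a‖ * ‖b‖)
    have e : ‖a‖ * ‖b‖ * (‖a‖⁻¹ * (‖b‖⁻¹ * ‖polarForm μ f a b‖)) = ‖polarForm μ f a b‖ := by
      field_simp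
    rw [e] at h2
    linarith
  refine ⟨ContinuousLinearMap.adjoint
    (InnerProductSpace.continuousLinearMapOfBilin (B.mkContinuous₂ _ hB)), fun ψ => ?_⟩
  rw [ContinuousLinearMap.adjoint_inner_right,
    InnerProductSpace.continuousLinearMapOfBilin_apply]
  exact l5 ψ

/-- Multiplicativity is extended one factor at a time: `step` keeps f in the class and frees g, with
S moved to the left slot as an adjoint; `main` then frees f with g fixed. -/
theorem isIntegralOf_mul (hμ : HasNormSqMass μ) {𝒞 : Set (X → ℂ)} (h𝒞 : GeneratesBddMeas 𝒞)
    (hb : ∀ f ∈ 𝒞, BddMeas f)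
    (h : ∀ f ∈ 𝒞, ∃ T, IsIntegralOf μ f T)
    (hmul : ∀ f ∈ 𝒞, ∀ g ∈ 𝒞, ∀ S T, IsIntegralOf μ f S → IsIntegralOf μ g T →
      IsIntegralOf μ (fun x => f x * g x) (S * T)) {f g : X → ℂ} (hf : BddMeas f) (hg : BddMeas g)
    {S T : 𝓗 →L[ℂ] 𝓗} (hS : IsIntegralOf μ f S) (hT : IsIntegralOf μ g T) :
    IsIntegralOf μ (fun x => f x * g x) (S * T) := by
  have step : ∀ f ∈ 𝒞, ∀ S, IsIntegralOf μ f S → ∀ φ ψ,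
      polarForm μ g (ContinuousLinearMap.adjoint S φ) ψ = polarForm μ (fun x => f x * g x) φ ψ := by
    intro f hf S hS
    refine h𝒞 (fun g => ∀ φ ψ, polarForm μ g (ContinuousLinearMap.adjoint S φ) ψ =
      polarForm μ (fun x => f x * g x) φ ψ) ?_ ?_ ?_ ?_ g hg
    · intro g hg φ ψ
      obtain ⟨T, hT⟩ := h g hg
      rw [← hT.inner, ← (hmul f hf g hg S T hS hT).inner, ContinuousLinearMap.adjoint_inner_left]
      rfl
    · intro g g' hg hg' ih ih' φ ψ
      simp only [mul_add]
      rw [polarForm_add hμ hg hg', ih, ih', polarForm_add hμ ((hb f hf).mul hg) ((hb f hf).mul hg')]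
    · intro c g hg ih φ ψ
      simp only [mul_left_comm (f _) c]
      rw [polarForm_const_mul, polarForm_const_mul, ih]
    · intro F g C hF hg hC hlim hP φ ψ
      obtain ⟨C', hC'⟩ := (hb f hf).bounded
      refine tendsto_nhds_unique (tendsto_polarForm hμ hF hC hlim _ _) ((tendsto_polarForm hμ
        (C := C' * C) (fun n => (hb f hf).mul (hF n)) (fun n x => ?_)
        (fun x => (hlim x).const_mul _) φ ψ).congr fun n => (hP n φ ψ).symm)
      rw [norm_mul]
      exact mul_le_mul (hC' x) (hC n x) (norm_nonneg _) ((norm_nonneg _).trans (hC' x))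
  have main : ∀ φ ψ, polarForm μ f φ (T ψ) = polarForm μ (fun x => f x * g x) φ ψ := by
    refine h𝒞 (fun f => ∀ φ ψ, polarForm μ f φ (T ψ) = polarForm μ (fun x => f x * g x) φ ψ)
      ?_ ?_ ?_ ?_ f hf
    · intro f hf φ ψ
      obtain ⟨S, hS⟩ := h f hf
      rw [← step f hf S hS, ← hT.inner, ← hS.inner, ContinuousLinearMap.adjoint_inner_left]
    · intro f f' hf hf' ih ih' φ ψ
      simp only [add_mul]
      rw [polarForm_add hμ hf hf', ih, ih', polarForm_add hμ (hf.mul hg) (hf'.mul hg)]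
    · intro c f hf ih φ ψ
      simp only [mul_assoc]
      rw [polarForm_const_mul, polarForm_const_mul, ih]
    · intro F f C hF hf hC hlim hP φ ψ
      obtain ⟨C', hC'⟩ := hg.bounded
      refine tendsto_nhds_unique (tendsto_polarForm hμ hF hC hlim _ _) ((tendsto_polarForm hμ
        (C := C * C') (fun n => (hF n).mul hg) (fun n x => ?_)
        (fun x => (hlim x).mul_const _) φ ψ).congr fun n => (hP n φ ψ).symm)
      rw [norm_mul]
      exact mul_le_mul (hC n x) (hC' x) (norm_nonneg _) ((norm_nonneg _).trans (hC n x))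
  obtain ⟨U, hU⟩ := exists_isIntegralOf hμ h𝒞 h (hf.mul hg)
  have : S * T = U := by
    ext ψ
    refine ext_inner_left ℂ fun φ => ?_
    rw [hU.inner, ← main, ← hS.inner]
    rfl
  rw [this]
  exact hU

end Families

/-! ### Bounded Borel calculus of a spectral family. -/

section SpectralFamilies

variable {𝓗 : Type*} [NormedAddCommGroup 𝓗] [InnerProductSpace ℂ 𝓗] [CompleteSpace 𝓗]
  {X : Type*} [MeasurableSpace X]

/-- A family of measures with a bounded measurable functional calculus. -/
structure IsSpectralFamily (μ : 𝓗 → Measure X) : Prop where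
  mass : HasNormSqMass μ
  exists_op : ∀ f, BddMeas f → ∃ T, IsIntegralOf μ f T
  mul : ∀ f g, BddMeas f → BddMeas g → ∀ S T, IsIntegralOf μ f S → IsIntegralOf μ g T →
    IsIntegralOf μ (fun x => f x * g x) (S * T)

/-- The operator with quadratic form `ψ ↦ ∫ f dμ_ψ`. -/
noncomputable def opIntegral (μ : 𝓗 → Measure X) (f : X → ℂ) : 𝓗 →L[ℂ] 𝓗 :=
  Classical.epsilon fun T : 𝓗 →L[ℂ] 𝓗 => ∀ ψ : 𝓗, ⟪ψ, T ψ⟫_ℂ = ∫ x, f x ∂(μ ψ)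

theorem IsIntegralOf.unique {μ : 𝓗 → Measure X} {f : X → ℂ} {S T : 𝓗 →L[ℂ] 𝓗}
    (hS : IsIntegralOf μ f S) (hT : IsIntegralOf μ f T) : S = T := by
  ext ψ
  exact ext_inner_left ℂ fun φ => by rw [hS.inner, hT.inner]

namespace IsSpectralFamily

variable {μ : 𝓗 → Measure X} (h : IsSpectralFamily μ) {f g : X → ℂ}
include h

theorem isFiniteMeasure (ψ : 𝓗) : IsFiniteMeasure (μ ψ) := h.mass.isFiniteMeasure ψ

theorem isIntegralOf (hf : BddMeas f) : IsIntegralOf μ f (opIntegral μ f) :=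
  Classical.epsilon_spec (h.exists_op f hf)

theorem op_eq {T : 𝓗 →L[ℂ] 𝓗} (hT : IsIntegralOf μ f T) : opIntegral μ f = T :=
  IsIntegralOf.unique (Classical.epsilon_spec ⟨T, hT⟩) hT

theorem op_mul (hf : BddMeas f) (hg : BddMeas g) :
    opIntegral μ (fun x => f x * g x) = opIntegral μ f * opIntegral μ g :=
  h.op_eq (h.mul f g hf hg _ _ (h.isIntegralOf hf) (h.isIntegralOf hg))

theorem op_mul_apply (hf : BddMeas f) (hg : BddMeas g) (ψ : 𝓗) :
    opIntegral μ f (opIntegral μ g ψ) = opIntegral μ (fun x => f x * g x) ψ := by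
  rw [h.op_mul hf hg]; rfl

theorem op_comm (hf : BddMeas f) (hg : BddMeas g) (ψ : 𝓗) :
    opIntegral μ f (opIntegral μ g ψ) = opIntegral μ g (opIntegral μ f ψ) := by
  rw [h.op_mul_apply hf hg, h.op_mul_apply hg hf]
  simp only [mul_comm]

theorem op_add (hf : BddMeas f) (hg : BddMeas g) :
    opIntegral μ (fun x => f x + g x) = opIntegral μ f + opIntegral μ g := by
  refine h.op_eq fun ψ => ?_
  have := h.isFiniteMeasure ψ
  rw [integral_add (hf.integrable _) (hg.integrable _), ← h.isIntegralOf hf ψ,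
    ← h.isIntegralOf hg ψ]
  simp [inner_add_right]

theorem op_const_mul (c : ℂ) (hf : BddMeas f) :
    opIntegral μ (fun x => c * f x) = c • opIntegral μ f := by
  refine h.op_eq fun ψ => ?_
  rw [integral_const_mul, ← h.isIntegralOf hf ψ]
  simp [inner_smul_right]

theorem op_sub (hf : BddMeas f) (hg : BddMeas g) :
    opIntegral μ (fun x => f x - g x) = opIntegral μ f - opIntegral μ g := by
  have := h.op_add hf (hg.const_mul (-1))
  rw [h.op_const_mul _ hg] at this
  simpa [sub_eq_add_neg] using this

theorem op_one : opIntegral μ (fun _ => 1) = 1 := by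
  refine h.op_eq fun ψ => ?_
  rw [integral_const, h.mass.real]
  simp

theorem op_adjoint (hf : BddMeas f) :
    ContinuousLinearMap.adjoint (opIntegral μ f) = opIntegral μ fun x => star (f x) := by
  refine (h.op_eq fun ψ => ?_).symm
  rw [ContinuousLinearMap.adjoint_inner_right, ← inner_conj_symm, h.isIntegralOf hf ψ,
    ← integral_conj]
  rfl

theorem inner_op_left (hf : BddMeas f) (φ ψ : 𝓗) :
    ⟪opIntegral μ f φ, ψ⟫_ℂ = ⟪φ, opIntegral μ (fun x => star (f x)) ψ⟫_ℂ := by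
  rw [← h.op_adjoint hf, ContinuousLinearMap.adjoint_inner_right]

/-- This isometry into L²(μ ψ) comes from f(H)*f(H) = |f|²(H). It carries the almost-everywhere
statements and the strong limits below. -/
theorem norm_sq_op (hf : BddMeas f) (ψ : 𝓗) :
    ‖opIntegral μ f ψ‖ ^ 2 = ∫ x, ‖f x‖ ^ 2 ∂(μ ψ) := by
  have h1 : ((‖opIntegral μ f ψ‖ ^ 2 : ℝ) : ℂ) = ((∫ x, ‖f x‖ ^ 2 ∂(μ ψ) : ℝ) : ℂ) := by
    have e := inner_self_eq_norm_sq_to_K (𝕜 := ℂ) (opIntegral μ f ψ)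
    rw [h.inner_op_left hf, h.op_mul_apply hf.conj hf, h.isIntegralOf (hf.conj.mul hf) ψ] at e
    push_cast
    rw [← integral_complex_ofReal]
    refine Eq.trans e.symm (integral_congr_ae (ae_of_all _ fun x => ?_))
    simp only [Complex.star_def]
    rw [mul_comm, Complex.mul_conj, Complex.normSq_eq_norm_sq]
  exact_mod_cast h1

theorem op_apply_eq_zero (hf : BddMeas f) {ψ : 𝓗} (h0 : ∀ᵐ x ∂(μ ψ), f x = 0) :
    opIntegral μ f ψ = 0 := by
  have h1 := h.norm_sq_op hf ψ
  rw [integral_eq_zero_of_ae (by filter_upwards [h0] with x hx; simp [hx])] at h1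
  simpa using h1

theorem op_apply_congr (hf : BddMeas f) (hg : BddMeas g) {ψ : 𝓗} (h0 : f =ᵐ[μ ψ] g) :
    opIntegral μ f ψ = opIntegral μ g ψ := by
  have := h.op_apply_eq_zero (hf.sub hg) (ψ := ψ) (by filter_upwards [h0] with x hx; simp [hx])
  rw [h.op_sub hf hg] at this
  exact sub_eq_zero.1 this

theorem ae_eq_zero_of_op_apply_eq_zero (hf : BddMeas f) {ψ : 𝓗} (h0 : opIntegral μ f ψ = 0) :
    ∀ᵐ x ∂(μ ψ), f x = 0 := by
  have := h.isFiniteMeasure ψ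
  have h1 := h.norm_sq_op hf ψ
  rw [h0, norm_zero, zero_pow two_ne_zero, eq_comm, integral_eq_zero_iff_of_nonneg
    (fun x => by positivity)] at h1
  · filter_upwards [h1] with x hx
    simpa using hx
  · refine ((hf.conj.mul hf).integrable (μ ψ)).norm.congr (ae_of_all _ fun x => ?_)
    simp [sq]

theorem eq_zero_of_measure_eq_zero {ψ : 𝓗} (h0 : μ ψ = 0) : ψ = 0 := by
  have := h.mass.real ψ
  rw [h0] at this
  simpa using this.symm

theorem tendsto_op {ι : Type*} {l : Filter ι} [l.IsCountablyGenerated] {F : ι → X → ℂ}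
    (hF : ∀ i, BddMeas (F i)) (hf : BddMeas f) {C : ℝ} (hC : ∀ᶠ i in l, ∀ x, ‖F i x‖ ≤ C)
    (hlim : ∀ x, Tendsto (fun i => F i x) l (𝓝 (f x))) (ψ : 𝓗) :
    Tendsto (fun i => opIntegral μ (F i) ψ) l (𝓝 (opIntegral μ f ψ)) := by
  have := h.isFiniteMeasure ψ
  rw [tendsto_iff_norm_sub_tendsto_zero]
  have key : Tendsto (fun i => ‖opIntegral μ (F i) ψ - opIntegral μ f ψ‖ ^ 2) l (𝓝 0) := by
    have e : ∀ i, ‖opIntegral μ (F i) ψ - opIntegral μ f ψ‖ ^ 2 =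
        ∫ x, ‖F i x - f x‖ ^ 2 ∂(μ ψ) := fun i => by
      rw [← h.norm_sq_op ((hF i).sub hf), h.op_sub (hF i) hf]; rfl
    simp only [e]
    obtain ⟨C', hC'⟩ := hf.bounded
    have := tendsto_integral_filter_of_dominated_convergence (μ := μ ψ) (l := l)
      (F := fun i x => ‖F i x - f x‖ ^ 2) (f := fun _ => (0 : ℝ)) (fun _ => (C + C') ^ 2)
      (Eventually.of_forall fun i =>
        (((hF i).sub hf).measurable.norm.pow_const 2).aestronglyMeasurable)
      (by
        filter_upwards [hC] with i hi
        refine ae_of_all _ fun x => ?_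
        rw [Real.norm_of_nonneg (by positivity)]
        gcongr
        exact (norm_sub_le _ _).trans (add_le_add (hi x) (hC' x)))
      (integrable_const _)
      (ae_of_all _ fun x => by
        have := ((hlim x).sub_const (f x)).norm.pow 2
        simpa using this)
    simpa using this
  have := key.sqrt
  simpa [Real.sqrt_sq (norm_nonneg _)] using this

/-- The mass of B is the squared norm of the operator of 1_B f at ψ. This makes domain conditions on
vectors f(H)η explicit. -/
theorem measure_op_apply (hf : BddMeas f) (ψ : 𝓗) :
    μ (opIntegral μ f ψ) = (μ ψ).withDensity fun x => ENNReal.ofReal (‖f x‖ ^ 2) := by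
  have := h.isFiniteMeasure
  have hint : Integrable (fun x => ‖f x‖ ^ 2) (μ ψ) := by
    refine ((hf.conj.mul hf).integrable (μ ψ)).norm.congr (ae_of_all _ fun x => ?_)
    simp [sq]
  ext B hB
  rw [withDensity_apply _ hB, ← ofReal_integral_eq_lintegral_ofReal hint.integrableOn
    (ae_of_all _ fun x => by positivity)]
  have hB' := BddMeas.indicator_one (X := X) hB
  have e1 := h.norm_sq_op hB' (opIntegral μ f ψ)
  rw [h.op_mul_apply hB' hf, h.norm_sq_op (hB'.mul hf)] at e1
  have e2 : ∫ x, ‖B.indicator (fun _ => (1 : ℂ)) x‖ ^ 2 ∂(μ (opIntegral μ f ψ)) =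
      (μ (opIntegral μ f ψ)).real B := by
    rw [← integral_indicator_one hB]
    refine integral_congr_ae (ae_of_all _ fun x => ?_)
    by_cases hx : x ∈ B <;> simp [hx]
  have e3 : ∫ x, ‖B.indicator (fun _ => (1 : ℂ)) x * f x‖ ^ 2 ∂(μ ψ) =
      ∫ x in B, ‖f x‖ ^ 2 ∂(μ ψ) := by
    rw [← integral_indicator hB]
    refine integral_congr_ae (ae_of_all _ fun x => ?_)
    by_cases hx : x ∈ B <;> simp [hx]
  rw [← e3, e1, e2, Measure.real, ENNReal.ofReal_toReal (measure_ne_top _ _)]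

end IsSpectralFamily

namespace ProjectionValuedMeasure

variable (E : ProjectionValuedMeasure 𝓗)

theorem measure_apply (ψ : 𝓗) {B : Set ℝ} (hB : MeasurableSet B) :
    E.measure ψ B = ENNReal.ofReal (‖E.proj B ψ‖ ^ 2) := by
  rw [measure, Measure.ofMeasurable_apply B hB, E.inner_proj hB]

theorem hasNormSqMass : HasNormSqMass E.measure := fun ψ => by
  rw [E.measure_apply ψ MeasurableSet.univ, E.proj_univ]
  rfl

theorem inner_self_proj {B : Set ℝ} (hB : MeasurableSet B) (ψ : 𝓗) :
    ⟪ψ, E.proj B ψ⟫_ℂ = (‖E.proj B ψ‖ ^ 2 : ℝ) := by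
  have h := E.isStarProjection B hB
  have hsa : ContinuousLinearMap.adjoint (E.proj B) = E.proj B := h.isSelfAdjoint
  have hid : E.proj B (E.proj B ψ) = E.proj B ψ :=
    congrArg (fun T : 𝓗 →L[ℂ] 𝓗 => T ψ) h.isIdempotentElem
  have e : ⟪ψ, E.proj B ψ⟫_ℂ = ⟪E.proj B ψ, E.proj B ψ⟫_ℂ := by
    rw [← ContinuousLinearMap.adjoint_inner_right, hsa, hid]
  rw [e, inner_self_eq_norm_sq_to_K]
  norm_cast

theorem isIntegralOf_indicator {B : Set ℝ} (hB : MeasurableSet B) :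
    IsIntegralOf E.measure (B.indicator fun _ => 1) (E.proj B) := fun ψ => by
  rw [E.inner_self_proj hB, integral_indicator hB, integral_const, measureReal_restrict_apply_univ,
    Measure.real, E.measure_apply ψ hB, ENNReal.toReal_ofReal (by positivity)]
  simp

theorem isSpectralFamily : IsSpectralFamily E.measure := by
  have hex : ∀ f ∈ {f : ℝ → ℂ | ∃ s, MeasurableSet s ∧ f = s.indicator fun _ => 1},
      ∃ T, IsIntegralOf E.measure f T := by
    rintro _ ⟨s, hs, rfl⟩
    exact ⟨_, E.isIntegralOf_indicator hs⟩
  refine ⟨E.hasNormSqMass, fun f hf => exists_isIntegralOf E.hasNormSqMass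
    generatesBddMeas_indicator hex hf, fun f g hf hg S T hS hT => isIntegralOf_mul E.hasNormSqMass
    generatesBddMeas_indicator ?_ hex ?_ hf hg hS hT⟩
  · rintro _ ⟨s, hs, rfl⟩
    exact .indicator_one hs
  · rintro _ ⟨s, hs, rfl⟩ _ ⟨t, ht, rfl⟩ S T hS hT
    rw [hS.unique (E.isIntegralOf_indicator hs), hT.unique (E.isIntegralOf_indicator ht),
      ← E.proj_inter s t hs ht]
    convert E.isIntegralOf_indicator (hs.inter ht) using 2 with x
    by_cases h1 : x ∈ s <;> by_cases h2 : x ∈ t <;> simp [h1, h2]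

end ProjectionValuedMeasure

end SpectralFamilies

/-! ### Existence of the resolvent at ±i. -/

namespace LinearPMap

variable {𝓗 : Type*} [NormedAddCommGroup 𝓗] [InnerProductSpace ℂ 𝓗] [CompleteSpace 𝓗]
  {H : 𝓗 →ₗ.[ℂ] 𝓗}

theorem inner_apply_comm_of_isSelfAdjoint (hH : IsSelfAdjoint H) (φ ψ : H.domain) :
    ⟪H φ, (ψ : 𝓗)⟫_ℂ = ⟪(φ : 𝓗), H ψ⟫_ℂ := by
  have h := adjoint_isFormalAdjoint hH.dense_domain
  have e : H.adjoint = H := hH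
  rw [e] at h
  exact h φ ψ

/-- The inclusion H* ⊆ H, used as a test for domain membership by weak identities. -/
theorem exists_apply_eq_of_isSelfAdjoint (hH : IsSelfAdjoint H) {x w : 𝓗}
    (h : ∀ φ : H.domain, ⟪H φ, x⟫_ℂ = ⟪(φ : 𝓗), w⟫_ℂ) : ∃ hx : x ∈ H.domain, H ⟨x, hx⟩ = w := by
  have e : H.adjoint = H := hH
  have h' : ∀ φ : H.domain, ⟪w, (φ : 𝓗)⟫_ℂ = ⟪x, H φ⟫_ℂ := fun φ => by
    rw [← inner_conj_symm, ← h φ, inner_conj_symm]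
  have hx : x ∈ H.adjoint.domain := mem_adjoint_domain_of_exists x ⟨w, h'⟩
  have hw : H.adjoint ⟨x, hx⟩ = w := adjoint_apply_eq hH.dense_domain ⟨x, hx⟩ h'
  have key : ∀ (K : 𝓗 →ₗ.[ℂ] 𝓗), K = H → ∀ hx : x ∈ K.domain, K ⟨x, hx⟩ = w →
      ∃ hx : x ∈ H.domain, H ⟨x, hx⟩ = w := by
    rintro K rfl hx hw
    exact ⟨hx, hw⟩
  exact key _ e hx hw

/-- The conditions on z mean z = ±i; the cross terms then cancel by symmetry of H. -/
theorem norm_sq_apply_sub_smul (hH : IsSelfAdjoint H) {z : ℂ} (hz : starRingEnd ℂ z = -z)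
    (hz' : z * z = -1) (ψ : H.domain) :
    ‖H ψ - z • (ψ : 𝓗)‖ ^ 2 = ‖H ψ‖ ^ 2 + ‖(ψ : 𝓗)‖ ^ 2 := by
  have h1 : ((‖H ψ - z • (ψ : 𝓗)‖ ^ 2 : ℝ) : ℂ) =
      ((‖H ψ‖ ^ 2 + ‖(ψ : 𝓗)‖ ^ 2 : ℝ) : ℂ) := by
    push_cast
    have e := fun x : 𝓗 => inner_self_eq_norm_sq_to_K (𝕜 := ℂ) x
    have e1 := e (H ψ - z • (ψ : 𝓗))
    have e2 := e (H ψ)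
    have e3 := e (ψ : 𝓗)
    simp only [Complex.coe_algebraMap] at e1 e2 e3
    rw [← e1, ← e2, ← e3]
    simp only [inner_sub_left, inner_sub_right, inner_smul_left, inner_smul_right,
      inner_apply_comm_of_isSelfAdjoint hH, hz]
    linear_combination (-⟪(ψ : 𝓗), (ψ : 𝓗)⟫_ℂ) * hz'
  exact_mod_cast h1

/-- `R` is the resolvent `(H - z)⁻¹`. -/
def IsResolventAt (H : 𝓗 →ₗ.[ℂ] 𝓗) (z : ℂ) (R : 𝓗 →L[ℂ] 𝓗) : Prop :=
  (∀ ψ : 𝓗, ∃ h : R ψ ∈ H.domain, H ⟨R ψ, h⟩ - z • R ψ = ψ) ∧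
    ∀ ψ : H.domain, R (H ψ - z • (ψ : 𝓗)) = ψ

/-- H - z is bounded below by 1, so it is injective, and its range is closed because H is closed. A
vector orthogonal to the range satisfies Hη = -zη with -z not real, which forces η = 0. -/
theorem exists_isResolventAt (hH : IsSelfAdjoint H) {z : ℂ} (hz : starRingEnd ℂ z = -z)
    (hz' : z * z = -1) : ∃ R, IsResolventAt H z R := by
  let S : H.domain →ₗ[ℂ] 𝓗 := H.toFun - z • H.domain.subtype
  have hS : ∀ ψ, S ψ = H ψ - z • (ψ : 𝓗) := fun _ => rfl
  have hle : ∀ ψ : H.domain, ‖(ψ : 𝓗)‖ ≤ ‖S ψ‖ := fun ψ => by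
    have := norm_sq_apply_sub_smul hH hz hz' ψ
    rw [hS]
    refine (sq_le_sq₀ (norm_nonneg _) (norm_nonneg _)).1 ?_
    rw [this]
    have := sq_nonneg ‖H ψ‖
    linarith
  have hclosed : _root_.IsClosed (LinearMap.range S : Set 𝓗) := by
    refine isClosed_of_closure_subset fun y hy => ?_
    obtain ⟨u, hu, hlim⟩ := mem_closure_iff_seq_limit.1 hy
    choose v hv using hu
    have hcau : CauchySeq fun n => (v n : 𝓗) := by
      have h1 := hlim.cauchySeq
      rw [Metric.cauchySeq_iff] at h1 ⊢
      intro ε hε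
      obtain ⟨N, hN⟩ := h1 ε hε
      refine ⟨N, fun m hm n hn => lt_of_le_of_lt ?_ (hN m hm n hn)⟩
      rw [dist_eq_norm, dist_eq_norm, ← hv, ← hv, ← S.map_sub]
      exact hle (v m - v n)
    obtain ⟨x, hx⟩ := cauchySeq_tendsto_of_complete hcau
    have hH' : Tendsto (fun n => H (v n)) atTop (𝓝 (y + z • x)) := by
      refine (hlim.add (hx.const_smul z)).congr fun n => ?_
      rw [← hv, hS, sub_add_cancel]
    obtain ⟨hxd, hxe⟩ := exists_apply_eq_of_isSelfAdjoint hH (x := x) (w := y + z • x)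
      fun φ => tendsto_nhds_unique (tendsto_const_nhds.inner hx)
        ((tendsto_const_nhds.inner hH').congr fun n =>
          (inner_apply_comm_of_isSelfAdjoint hH φ (v n)).symm)
    exact ⟨⟨x, hxd⟩, by rw [hS, hxe]; simp⟩
  have hbot : (LinearMap.range S)ᗮ = ⊥ := by
    refine (Submodule.eq_bot_iff _).2 fun η hη => ?_
    have h1 : ∀ φ : H.domain, ⟪H φ, η⟫_ℂ = ⟪(φ : 𝓗), (-z) • η⟫_ℂ := fun φ => by
      have := (Submodule.mem_orthogonal _ _).1 hη _ ⟨φ, rfl⟩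
      rw [hS, inner_sub_left, inner_smul_left, hz, sub_eq_zero] at this
      rw [this, inner_smul_right]
    obtain ⟨hd, he⟩ := exists_apply_eq_of_isSelfAdjoint hH h1
    have h2 := inner_apply_comm_of_isSelfAdjoint hH ⟨η, hd⟩ ⟨η, hd⟩
    have hc : starRingEnd ℂ (-z) = z := by simp [hz]
    rw [he, inner_smul_left, inner_smul_right, hc] at h2
    have h3 : (2 * z) * ⟪η, η⟫_ℂ = 0 := by linear_combination h2
    have hz0 : z ≠ 0 := by rintro rfl; simp at hz'
    simpa [hz0] using h3
  have htop : LinearMap.range S = ⊤ := by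
    have : CompleteSpace (LinearMap.range S) := hclosed.completeSpace_coe
    exact (Submodule.orthogonal_eq_bot_iff).1 hbot
  have hinj : Function.Injective S := by
    refine (injective_iff_map_eq_zero S).2 fun ψ h0 => ?_
    have := hle ψ
    rw [h0, norm_zero] at this
    exact Subtype.ext (norm_le_zero_iff.1 this)
  let e := LinearEquiv.ofBijective S ⟨hinj, LinearMap.range_eq_top.1 htop⟩
  have he : ∀ ψ, S (e.symm ψ) = ψ := fun ψ => e.apply_symm_apply ψ
  refine ⟨LinearMap.mkContinuous (H.domain.subtype ∘ₗ e.symm.toLinearMap) 1 fun ψ => ?_,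
    fun ψ => ⟨(e.symm ψ).2, he ψ⟩, fun ψ => ?_⟩
  · rw [one_mul]
    refine (hle _).trans ?_
    rw [show S (e.symm.toLinearMap ψ) = ψ from he ψ]
  · exact congrArg Subtype.val (e.symm_apply_apply ψ)

end LinearPMap

/-! ### From a continuous functional calculus to scalar measures. -/

section ContinuousCalculus

open scoped CompactlySupported

variable {𝓗 : Type*} [NormedAddCommGroup 𝓗] [InnerProductSpace ℂ 𝓗] [CompleteSpace 𝓗]
  {X : Type*} [TopologicalSpace X] [CompactSpace X] (Φ : C(X, ℂ) →⋆ₐ[ℂ] (𝓗 →L[ℂ] 𝓗))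

/-- A real continuous function, viewed as a complex one. -/
def ContinuousMap.toComplex (f : C(X, ℝ)) : C(X, ℂ) := ⟨fun x => f x, by fun_prop⟩

/-- A nonnegative f is s*s with s = √f, so the form is ‖Φ(s)ψ‖². -/
theorem inner_starAlgHom_toComplex_nonneg (f : C(X, ℝ)) (hf : ∀ x, 0 ≤ f x) (ψ : 𝓗) :
    ∃ c : ℝ, 0 ≤ c ∧ ⟪ψ, Φ f.toComplex ψ⟫_ℂ = c := by
  let s : C(X, ℝ) := ⟨fun x => Real.sqrt (f x), by fun_prop⟩
  have e : f.toComplex = star s.toComplex * s.toComplex := by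
    ext x
    change ((f x : ℝ) : ℂ) = starRingEnd ℂ ((Real.sqrt (f x) : ℝ) : ℂ) * (Real.sqrt (f x) : ℝ)
    rw [Complex.conj_ofReal, ← Complex.ofReal_mul, Real.mul_self_sqrt (hf x)]
  refine ⟨‖Φ s.toComplex ψ‖ ^ 2, by positivity, ?_⟩
  rw [e, map_mul, map_star, ContinuousLinearMap.star_eq_adjoint, mul_apply_eq_comp,
    ContinuousLinearMap.adjoint_inner_right, inner_self_eq_norm_sq_to_K]
  norm_cast

/-- The positive functional `f ↦ ⟨ψ, Φ(f) ψ⟩`. -/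
noncomputable def vectorFunctional (ψ : 𝓗) : C_c(X, ℝ) →ₚ[ℝ] ℝ :=
  PositiveLinearMap.mk₀
    { toFun := fun f => (⟪ψ, Φ (f : C(X, ℝ)).toComplex ψ⟫_ℂ).re
      map_add' := fun f g => by
        have : ((f + g : C_c(X, ℝ)) : C(X, ℝ)).toComplex =
            (f : C(X, ℝ)).toComplex + (g : C(X, ℝ)).toComplex := by
          ext x
          exact Complex.ofReal_add _ _
        rw [this, map_add, add_apply, inner_add_right, Complex.add_re]
      map_smul' := fun c f => by
        have : ((c • f : C_c(X, ℝ)) : C(X, ℝ)).toComplex =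
            (c : ℂ) • (f : C(X, ℝ)).toComplex := by
          ext x
          exact Complex.ofReal_mul _ _
        rw [this, map_smul, smul_apply, inner_smul_right,
          Complex.re_ofReal_mul]
        rfl }
    fun f hf => by
      obtain ⟨c, hc, h⟩ := inner_starAlgHom_toComplex_nonneg Φ (f : C(X, ℝ)) (fun x => hf x) ψ
      change 0 ≤ (⟪ψ, Φ (f : C(X, ℝ)).toComplex ψ⟫_ℂ).re
      rw [h]
      exact hc

variable [T2Space X] [MeasurableSpace X] [BorelSpace X]

theorem integral_rieszMeasure_vectorFunctional (ψ : 𝓗) (f : C(X, ℂ)) :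
    ⟪ψ, Φ f ψ⟫_ℂ = ∫ x, f x ∂(RealRMK.rieszMeasure (vectorFunctional Φ ψ)) := by
  have hreal : ∀ f : C(X, ℝ), ⟪ψ, Φ f.toComplex ψ⟫_ℂ =
      ((∫ x, f x ∂(RealRMK.rieszMeasure (vectorFunctional Φ ψ)) : ℝ) : ℂ) := by
    intro f
    have h1 := RealRMK.integral_rieszMeasure (vectorFunctional Φ ψ)
      (CompactlySupportedContinuousMap.continuousMapEquiv f)
    have h2 : vectorFunctional Φ ψ (CompactlySupportedContinuousMap.continuousMapEquiv f) =
      (⟪ψ, Φ f.toComplex ψ⟫_ℂ).re := rfl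
    rw [h2] at h1
    refine Eq.trans ?_ (congrArg Complex.ofReal h1).symm
    -- Riesz–Markov gives the real part; the imaginary part vanishes since Φ of a real function is
    -- self-adjoint.
    refine Complex.ext rfl ?_
    rw [Complex.ofReal_im, ← Complex.conj_eq_iff_im, inner_conj_symm,
      ← ContinuousLinearMap.adjoint_inner_right, ← ContinuousLinearMap.star_eq_adjoint, ← map_star]
    congr 3
    ext x
    exact Complex.conj_ofReal _
  let u : C(X, ℝ) := ⟨fun x => (f x).re, by fun_prop⟩
  let v : C(X, ℝ) := ⟨fun x => (f x).im, by fun_prop⟩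
  have e : f = u.toComplex + Complex.I • v.toComplex := by
    ext x
    change f x = ((f x).re : ℂ) + Complex.I * ((f x).im : ℂ)
    rw [mul_comm, Complex.re_add_im]
  have hint : Integrable f (RealRMK.rieszMeasure (vectorFunctional Φ ψ)) :=
    f.continuous.integrable_of_hasCompactSupport (HasCompactSupport.of_compactSpace _)
  calc ⟪ψ, Φ f ψ⟫_ℂ = ⟪ψ, Φ u.toComplex ψ⟫_ℂ + Complex.I * ⟪ψ, Φ v.toComplex ψ⟫_ℂ := by
        conv_lhs => rw [e]
        simp [inner_add_right, inner_smul_right]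
    _ = _ := by
        rw [hreal, hreal, mul_comm]
        exact integral_re_add_im hint

theorem exists_isSpectralFamily_of_starAlgHom [HasOuterApproxClosed X] :
    ∃ μ : 𝓗 → Measure X, IsSpectralFamily μ ∧ ∀ f : C(X, ℂ), IsIntegralOf μ f (Φ f) := by
  let μ : 𝓗 → Measure X := fun ψ => RealRMK.rieszMeasure (vectorFunctional Φ ψ)
  have hμ : ∀ f : C(X, ℂ), IsIntegralOf μ f (Φ f) := fun f ψ =>
    integral_rieszMeasure_vectorFunctional Φ ψ f
  have hmass : HasNormSqMass μ := fun ψ => by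
    have h1 := hμ 1 ψ
    rw [map_one, one_apply_eq_self, inner_self_eq_norm_sq_to_K] at h1
    have h2 : ∫ x, (1 : C(X, ℂ)) x ∂(μ ψ) = ((μ ψ).real Set.univ : ℂ) := by simp
    rw [h2] at h1
    have h3 : ‖ψ‖ ^ 2 = (μ ψ).real Set.univ := by
      simp only [Complex.coe_algebraMap] at h1
      exact_mod_cast h1
    have : μ ψ Set.univ ≠ ∞ := by
      have : IsFiniteMeasureOnCompacts (μ ψ) := by
        change IsFiniteMeasureOnCompacts (RealRMK.rieszMeasure (vectorFunctional Φ ψ))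
        infer_instance
      exact isCompact_univ.measure_lt_top.ne
    rw [h3, Measure.real, ENNReal.ofReal_toReal this]
  have hex : ∀ f ∈ {f : X → ℂ | Continuous f ∧ ∃ C : ℝ, ∀ x, ‖f x‖ ≤ C},
      ∃ T, IsIntegralOf μ f T := fun f hf => ⟨_, hμ ⟨f, hf.1⟩⟩
  refine ⟨μ, ⟨hmass, fun f hf => exists_isIntegralOf hmass generatesBddMeas_continuous hex hf,
    fun f g hf hg S T hS hT => isIntegralOf_mul hmass generatesBddMeas_continuous
      (fun f hf => ⟨hf.1.measurable, hf.2⟩) hex ?_ hf hg hS hT⟩, hμ⟩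
  intro f hf g hg S T hS hT
  rw [hS.unique (hμ ⟨f, hf.1⟩), hT.unique (hμ ⟨g, hg.1⟩), ← map_mul]
  exact hμ _

end ContinuousCalculus

/-! ### Image of a spectral family on the real line. -/

section Pushforward

variable {𝓗 : Type*} [NormedAddCommGroup 𝓗] [InnerProductSpace ℂ 𝓗] [CompleteSpace 𝓗]
  {X : Type*} [MeasurableSpace X] {μ : 𝓗 → Measure X}

/-- The projection-valued measure on `ℝ` given by the image of a spectral family under a Borel
function. -/
noncomputable def IsSpectralFamily.pvm (h : IsSpectralFamily μ) (κ : X → ℝ) (hκ : Measurable κ) :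
    ProjectionValuedMeasure 𝓗 where
  proj B := opIntegral μ ((κ ⁻¹' B).indicator fun _ => 1)
  isStarProjection B hB := by
    have hb := BddMeas.indicator_one (hκ hB)
    refine ⟨?_, ?_⟩
    · rw [IsIdempotentElem, ← h.op_mul hb hb]
      congr 1
      ext x
      by_cases hx : x ∈ κ ⁻¹' B <;> simp [hx]
    · rw [IsSelfAdjoint, ContinuousLinearMap.star_eq_adjoint, h.op_adjoint hb]
      congr 1
      ext x
      by_cases hx : x ∈ κ ⁻¹' B <;> simp [hx]
  proj_univ := by
    rw [← h.op_one]
    simp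
  proj_inter B C hB hC := by
    rw [← h.op_mul (BddMeas.indicator_one (hκ hB)) (BddMeas.indicator_one (hκ hC))]
    congr 1
    ext x
    by_cases hx : x ∈ κ ⁻¹' B <;> by_cases hx' : x ∈ κ ⁻¹' C <;>
      simp_all
  hasSum_proj B hB hd ψ := by
    have hb := fun n => BddMeas.indicator_one (hκ (hB n))
    -- Partial sums are projections of finite unions, so σ-additivity becomes a bounded pointwise
    -- limit of indicators.
    have hfin : ∀ s : Finset ℕ, ∑ n ∈ s, opIntegral μ ((κ ⁻¹' B n).indicator fun _ => 1) =
        opIntegral μ ((κ ⁻¹' ⋃ n ∈ s, B n).indicator fun _ => 1) := by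
      intro s
      induction s using Finset.induction_on with
      | empty =>
        have := h.op_const_mul 0 (BddMeas.const (X := X) 1)
        simpa using this.symm
      | insert n s hn ih =>
        have hs : MeasurableSet (⋃ n ∈ s, B n) := Finset.measurableSet_biUnion _ fun i _ => hB i
        rw [Finset.sum_insert hn, ih, ← h.op_add (hb n) (.indicator_one (hκ hs)),
          Finset.set_biUnion_insert, Set.preimage_union]
        congr 1
        rw [Set.indicator_union_of_disjoint]
        exact (Set.disjoint_iUnion₂_right.2 fun i hi => hd (by rintro rfl; exact hn hi)).preimage κ
    have hs : ∀ s : Finset ℕ, MeasurableSet (⋃ n ∈ s, B n) := fun s =>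
      Finset.measurableSet_biUnion _ fun i _ => hB i
    refine (h.tendsto_op (l := atTop) (C := 1) (fun s : Finset ℕ => .indicator_one (hκ (hs s)))
      (.indicator_one (hκ (.iUnion hB))) (Eventually.of_forall fun s x => ?_) (fun x => ?_)
      ψ).congr fun s => ?_
    · by_cases hx : x ∈ κ ⁻¹' ⋃ n ∈ s, B n
      · rw [Set.indicator_of_mem hx]; simp
      · rw [Set.indicator_of_notMem hx]; simp
    · by_cases hx : κ x ∈ ⋃ n, B n
      · obtain ⟨i, hi⟩ := Set.mem_iUnion.1 hx
        refine tendsto_const_nhds.congr' ?_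
        filter_upwards [eventually_ge_atTop {i}] with s hs
        rw [Set.indicator_of_mem (Set.mem_preimage.2 hx), Set.indicator_of_mem]
        exact Set.mem_preimage.2 (Set.mem_biUnion (Finset.mem_coe.2 (hs (by simp))) hi)
      · refine tendsto_const_nhds.congr fun s => ?_
        rw [Set.indicator_of_notMem (by simpa using hx), Set.indicator_of_notMem]
        intro hm
        obtain ⟨i, _, hi⟩ := Set.mem_iUnion₂.1 (Set.mem_preimage.1 hm)
        exact hx (Set.mem_iUnion.2 ⟨i, hi⟩)
    · rw [← hfin, sum_apply]

theorem IsSpectralFamily.pvm_measure (h : IsSpectralFamily μ) (κ : X → ℝ) (hκ : Measurable κ)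
    (ψ : 𝓗) : (h.pvm κ hκ).measure ψ = (μ ψ).map κ := by
  have := h.isFiniteMeasure
  ext B hB
  rw [ProjectionValuedMeasure.measure_apply _ _ hB, Measure.map_apply hκ hB]
  change ENNReal.ofReal (‖opIntegral μ ((κ ⁻¹' B).indicator fun _ => 1) ψ‖ ^ 2) = _
  rw [h.norm_sq_op (.indicator_one (hκ hB))]
  have : ∫ x, ‖(κ ⁻¹' B).indicator (fun _ => (1 : ℂ)) x‖ ^ 2 ∂(μ ψ) = (μ ψ).real (κ ⁻¹' B) := by
    rw [← integral_indicator_one (hκ hB)]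
    refine integral_congr_ae (ae_of_all _ fun x => ?_)
    by_cases hx : x ∈ κ ⁻¹' B <;> simp [hx]
  rw [this, Measure.real, ENNReal.ofReal_toReal (measure_ne_top _ _)]

end Pushforward

/-! ### Resolvent identities and normality. -/

namespace LinearPMap

variable {𝓗 : Type*} [NormedAddCommGroup 𝓗] [InnerProductSpace ℂ 𝓗] [CompleteSpace 𝓗]
  {H : 𝓗 →ₗ.[ℂ] 𝓗}

theorem IsResolventAt.apply_eq {z : ℂ} {R : 𝓗 →L[ℂ] 𝓗} (hR : IsResolventAt H z R) (ψ : 𝓗) :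
    ∃ h : R ψ ∈ H.domain, H ⟨R ψ, h⟩ = ψ + z • R ψ := by
  obtain ⟨h, e⟩ := hR.1 ψ
  exact ⟨h, sub_eq_iff_eq_add.1 e⟩

theorem IsResolventAt.injective {z : ℂ} {R : 𝓗 →L[ℂ] 𝓗} (hR : IsResolventAt H z R) {ψ : 𝓗}
    (h0 : R ψ = 0) : ψ = 0 := by
  obtain ⟨h, e⟩ := hR.1 ψ
  have : (⟨R ψ, h⟩ : H.domain) = 0 := Subtype.ext h0
  rw [this, H.map_zero, h0] at e
  simpa using e.symm

theorem IsResolventAt.mem_range {z : ℂ} {R : 𝓗 →L[ℂ] 𝓗} (hR : IsResolventAt H z R)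
    (ψ : H.domain) : ∃ η, R η = ψ ∧ η = H ψ - z • (ψ : 𝓗) := ⟨_, hR.2 ψ, rfl⟩

/-- Symmetry of H tested on Rφ and Rψ, where HR = 1 + zR; this is the weak form of R - R* = 2zR*R.
-/
theorem IsResolventAt.inner_sub (hH : IsSelfAdjoint H) {z : ℂ} (hz : starRingEnd ℂ z = -z)
    {R : 𝓗 →L[ℂ] 𝓗} (hR : IsResolventAt H z R) (φ ψ : 𝓗) :
    ⟪φ, R ψ⟫_ℂ - ⟪R φ, ψ⟫_ℂ = 2 * z * ⟪R φ, R ψ⟫_ℂ := by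
  obtain ⟨h1, e1⟩ := hR.apply_eq φ
  obtain ⟨h2, e2⟩ := hR.apply_eq ψ
  have := inner_apply_comm_of_isSelfAdjoint hH ⟨_, h1⟩ ⟨_, h2⟩
  rw [e1, e2, inner_add_left, inner_add_right, inner_smul_left, inner_smul_right, hz] at this
  linear_combination this

theorem IsResolventAt.sub_adjoint (hH : IsSelfAdjoint H) {z : ℂ} (hz : starRingEnd ℂ z = -z)
    {R : 𝓗 →L[ℂ] 𝓗} (hR : IsResolventAt H z R) :
    R - star R = (2 * z) • (star R * R) := by
  ext ψ
  refine ext_inner_left ℂ fun φ => ?_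
  have := hR.inner_sub hH hz φ ψ
  rw [ContinuousLinearMap.star_eq_adjoint, _root_.sub_apply, inner_sub_right,
    ContinuousLinearMap.adjoint_inner_right, this, _root_.smul_apply, inner_smul_right,
    mul_apply_eq_comp, ContinuousLinearMap.adjoint_inner_right]

theorem IsResolventAt.eq_star (hH : IsSelfAdjoint H) {z : ℂ} (hz : starRingEnd ℂ z = -z)
    {R S : 𝓗 →L[ℂ] 𝓗} (hR : IsResolventAt H z R) (hS : IsResolventAt H (-z) S) : S = star R := by
  ext ψ
  refine ext_inner_right ℂ fun φ => ?_
  obtain ⟨h1, e1⟩ := hS.apply_eq ψ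
  obtain ⟨h2, e2⟩ := hR.apply_eq φ
  have := inner_apply_comm_of_isSelfAdjoint hH ⟨_, h1⟩ ⟨_, h2⟩
  rw [e1, e2, inner_add_left, inner_add_right, inner_smul_left, inner_smul_right, _root_.map_neg, hz]
    at this
  rw [ContinuousLinearMap.star_eq_adjoint, ContinuousLinearMap.adjoint_inner_left]
  linear_combination -this

/-- R* is the resolvent at -z, so the identity at z and at -z gives 2zR*R = R - R* = 2zRR*. -/
theorem IsResolventAt.isStarNormal (hH : IsSelfAdjoint H) {z : ℂ} (hz : starRingEnd ℂ z = -z)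
    (hz' : z * z = -1) {R : 𝓗 →L[ℂ] 𝓗} (hR : IsResolventAt H z R) : IsStarNormal R := by
  have hnz : starRingEnd ℂ (-z) = -(-z) := by rw [_root_.map_neg, hz]
  obtain ⟨S, hS⟩ := exists_isResolventAt hH hnz (by rw [neg_mul_neg, hz'])
  have e := hR.eq_star hH hz hS
  subst e
  have h1 := hR.sub_adjoint hH hz
  have h2 := hS.sub_adjoint hH hnz
  rw [star_star] at h2
  have hz0 : (2 * z) ≠ 0 := by
    rintro h
    have : z = 0 := by simpa using h
    rw [this] at hz'
    simp at hz'
  refine ⟨smul_right_injective _ hz0 ?_⟩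
  change (2 * z) • (star R * R) = (2 * z) • (R * star R)
  rw [← h1, ← neg_sub, h2, ← neg_smul]
  congr 1
  ring

end LinearPMap

/-! ### The spectral theorem, via the resolvent. -/

namespace ProjectionValuedMeasure

variable {𝓗 : Type*} [NormedAddCommGroup 𝓗] [InnerProductSpace ℂ 𝓗] [CompleteSpace 𝓗]
  {H : 𝓗 →ₗ.[ℂ] 𝓗} {X : Type*} [MeasurableSpace X] {μ : 𝓗 → Measure X} {z : X → ℂ}
  {R : 𝓗 →L[ℂ] 𝓗}

open LinearPMap

/-- Almost everywhere z = 1/(x - i) with x real: injectivity of R excludes z = 0, and R - R* = 2iR*R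
becomes z - z̄ = 2i|z|², that is, Im(1/z) = -1. -/
theorem ae_inv_eq_of_isResolventAt (hH : IsSelfAdjoint H) (hR : IsResolventAt H Complex.I R)
    (hμ : IsSpectralFamily μ) (hz : BddMeas z) (hzR : opIntegral μ z = R) (ψ : 𝓗) :
    ∀ᵐ x ∂(μ ψ), z x * ((z x)⁻¹.re - Complex.I) = 1 := by
  have hm : MeasurableSet (z ⁻¹' {0}) := hz.measurable (measurableSet_singleton 0)
  have hb := BddMeas.indicator_one hm
  have h1 : ∀ᵐ x ∂(μ ψ), z x ≠ 0 := by
    have h0 : opIntegral μ ((z ⁻¹' {0}).indicator fun _ => 1) ψ = 0 := by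
      refine hR.injective ?_
      rw [← hzR, hμ.op_mul_apply hz hb]
      refine hμ.op_apply_eq_zero (hz.mul hb) (ae_of_all _ fun x => ?_)
      by_cases hx : z x = 0
      · rw [hx, zero_mul]
      · rw [Set.indicator_of_notMem (by simpa using hx), mul_zero]
    filter_upwards [hμ.ae_eq_zero_of_op_apply_eq_zero hb h0] with x hx h
    rw [Set.indicator_of_mem (by simpa using h)] at hx
    exact one_ne_zero hx
  have h2 : ∀ᵐ x ∂(μ ψ), z x - star (z x) - 2 * Complex.I * (star (z x) * z x) = 0 := by
    have hb := (hz.conj.mul hz).const_mul (2 * Complex.I)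
    refine hμ.ae_eq_zero_of_op_apply_eq_zero ((hz.sub hz.conj).sub hb) ?_
    rw [hμ.op_sub (hz.sub hz.conj) hb, hμ.op_sub hz hz.conj,
      hμ.op_const_mul _ (hz.conj.mul hz), hμ.op_mul hz.conj hz, ← hμ.op_adjoint hz, hzR,
      ← ContinuousLinearMap.star_eq_adjoint, hR.sub_adjoint hH Complex.conj_I, sub_self]
    rfl
  filter_upwards [h1, h2] with x h1 h2
  have h3 : (z x)⁻¹ = (z x)⁻¹.re - Complex.I := by
    have h4 : star (z x) ≠ 0 := star_ne_zero.2 h1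
    have h5 : starRingEnd ℂ (z x)⁻¹ - (z x)⁻¹ = 2 * Complex.I := by
      rw [map_inv₀]
      rw [Complex.star_def] at h2 h4
      field_simp
      linear_combination h2
    have h6 := congrArg Complex.im h5
    refine Complex.ext (by simp) ?_
    simp only [Complex.sub_im, Complex.conj_im, Complex.mul_im, Complex.re_ofNat,
      Complex.I_im, Complex.im_ofNat, Complex.I_re, Complex.ofReal_im] at h6 ⊢
    linarith
  rw [← h3, mul_inv_cancel₀ h1]

/-- The domain is the range of R. For ψ = Rη the measure has density |z|², and |Re(1/z)||z| ≤ 1.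
Conversely, η is recovered as the limit of truncations of κ - i applied to ψ. -/
theorem integrable_sq_iff_mem_domain (hH : IsSelfAdjoint H) (hR : IsResolventAt H Complex.I R)
    (hμ : IsSpectralFamily μ) (hz : BddMeas z) (hzR : opIntegral μ z = R) (ψ : 𝓗) :
    ψ ∈ H.domain ↔ Integrable (fun x => (z x)⁻¹.re ^ 2) (μ ψ) := by
  have := hμ.isFiniteMeasure
  have hκ : Measurable fun x => (z x)⁻¹.re := Complex.measurable_re.comp hz.measurable.inv
  constructor
  · intro hψ
    obtain ⟨η, hη, -⟩ := hR.mem_range ⟨ψ, hψ⟩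
    have hη : R η = ψ := hη
    rw [← hη, ← hzR, hμ.measure_op_apply hz, integrable_withDensity_iff
      (hz.measurable.norm.pow_const 2).ennreal_ofReal (ae_of_all _ fun _ => ENNReal.ofReal_lt_top)]
    refine Integrable.of_bound (C := 1) ?_ (ae_of_all _ fun x => ?_)
    · exact ((hκ.pow_const 2).mul (hz.measurable.norm.pow_const 2).ennreal_ofReal.ennreal_toReal
        ).aestronglyMeasurable
    · rw [ENNReal.toReal_ofReal (by positivity), ← mul_pow, Real.norm_of_nonneg (by positivity),
        sq_le_one_iff_abs_le_one, abs_mul, abs_norm]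
      calc |(z x)⁻¹.re| * ‖z x‖ ≤ ‖(z x)⁻¹‖ * ‖z x‖ := by
            gcongr
            exact Complex.abs_re_le_norm _
        _ ≤ 1 := by
            rw [norm_inv]
            exact inv_mul_le_one
  · intro hint
    set κ : X → ℝ := fun x => (z x)⁻¹.re
    have hms : ∀ n : ℕ, MeasurableSet {x | |κ x| ≤ n} := fun n =>
      measurableSet_le hκ.abs measurable_const
    let f : ℕ → X → ℂ := fun n => {x | |κ x| ≤ n}.indicator fun x => κ x - Complex.I
    have hfin : ∀ (n : ℕ) x, |κ x| ≤ n → f n x = κ x - Complex.I := fun n x hx =>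
      Set.indicator_of_mem (s := {x | |κ x| ≤ n}) hx _
    have hfout : ∀ (n : ℕ) x, ¬|κ x| ≤ n → f n x = 0 := fun n x hx =>
      Set.indicator_of_notMem (s := {x | |κ x| ≤ n}) hx _
    have hf : ∀ n, BddMeas (f n) := fun n => by
      refine ⟨((Complex.measurable_ofReal.comp hκ).sub measurable_const).indicator (hms n), n + 1,
        fun x => ?_⟩
      by_cases hx : |κ x| ≤ n
      · rw [hfin n x hx]
        refine (norm_sub_le _ _).trans ?_
        rw [Complex.norm_real, Complex.norm_I]
        simpa using hx
      · rw [hfout n x hx]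
        simp only [norm_zero]
        positivity
    have hg : Integrable (fun x => κ x ^ 2 + 1) (μ ψ) := hint.add (integrable_const 1)
    -- The tail of |κ - i|² = κ² + 1; it bounds the squared distance of any two truncations of level
    -- at least N.
    let b : ℕ → ℝ := fun N => ∫ x, {x | |κ x| ≤ N}ᶜ.indicator (fun x => κ x ^ 2 + 1) x ∂(μ ψ)
    have hb : Tendsto b atTop (𝓝 0) := by
      have := tendsto_integral_of_dominated_convergence (μ := μ ψ)
        (F := fun (N : ℕ) => {x | |κ x| ≤ N}ᶜ.indicator (fun x => κ x ^ 2 + 1))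
        (f := fun _ => (0 : ℝ)) (fun x => κ x ^ 2 + 1)
        (fun N => (hg.indicator (hms N).compl).aestronglyMeasurable) hg
        (fun N => ae_of_all _ fun x => by
          refine (norm_indicator_le_norm_self _ _).trans ?_
          rw [Real.norm_of_nonneg (by positivity)])
        (ae_of_all _ fun x => by
          refine tendsto_const_nhds.congr' ?_
          filter_upwards [eventually_ge_atTop ⌈|κ x|⌉₊] with N hN
          rw [Set.indicator_of_notMem]
          simpa using (Nat.le_ceil _).trans (Nat.cast_le.2 hN))
      simpa using this
    have hdist : ∀ n m N : ℕ, N ≤ n → N ≤ m →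
        dist (opIntegral μ (f n) ψ) (opIntegral μ (f m) ψ) ≤ Real.sqrt (b N) := by
      intro n m N hn hm
      rw [dist_eq_norm]
      refine Real.le_sqrt_of_sq_le ?_
      have e : opIntegral μ (f n) ψ - opIntegral μ (f m) ψ =
          opIntegral μ (fun x => f n x - f m x) ψ := by
        rw [hμ.op_sub (hf n) (hf m)]; rfl
      rw [e, hμ.norm_sq_op ((hf n).sub (hf m))]
      refine integral_mono_of_nonneg (ae_of_all _ fun x => by positivity)
        (hg.indicator (hms N).compl) (ae_of_all _ fun x => ?_)
      have hn' : (N : ℝ) ≤ n := Nat.cast_le.2 hn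
      have hm' : (N : ℝ) ≤ m := Nat.cast_le.2 hm
      have hnorm : ‖(κ x : ℂ) - Complex.I‖ ^ 2 = κ x ^ 2 + 1 := by
        rw [← Complex.normSq_eq_norm_sq, Complex.normSq_apply]
        simp
        ring
      by_cases hx : |κ x| ≤ N
      · have h1 := hfin n x (hx.trans hn')
        have h2 := hfin m x (hx.trans hm')
        simp only [h1, h2, sub_self, norm_zero]
        rw [Set.indicator_of_notMem (by simpa using hx)]
        simp
      · rw [Set.indicator_of_mem (show x ∈ {x | |κ x| ≤ N}ᶜ from hx), ← hnorm]
        have hc : ∀ k : ℕ, f k x = κ x - Complex.I ∨ f k x = 0 := fun k =>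
          (em (|κ x| ≤ k)).imp (hfin k x) (hfout k x)
        rcases hc n with h1 | h1 <;> rcases hc m with h2 | h2 <;> simp only [h1, h2]
        · simp
        · simp
        · rw [zero_sub, norm_neg]
        · simp
    have hcau : CauchySeq fun n => opIntegral μ (f n) ψ := by
      refine cauchySeq_of_le_tendsto_0 (fun N => Real.sqrt (b N)) hdist ?_
      simpa using hb.sqrt
    obtain ⟨η, hη⟩ := cauchySeq_tendsto_of_complete hcau
    have h1 : Tendsto (fun n => R (opIntegral μ (f n) ψ)) atTop (𝓝 (R η)) :=
      (R.continuous.tendsto η).comp hη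
    -- Since z(κ - i) = 1 almost everywhere, R undoes the truncated H - i up to the cutoff
    -- indicator.
    have h2 : Tendsto (fun n => R (opIntegral μ (f n) ψ)) atTop (𝓝 ψ) := by
      have h3 := hμ.tendsto_op (l := atTop) (C := 1)
        (fun n : ℕ => BddMeas.indicator_one (hms n)) (BddMeas.const 1)
        (Eventually.of_forall fun n x => by
          by_cases hx : x ∈ {x | |κ x| ≤ n}
          · rw [Set.indicator_of_mem hx]; simp
          · rw [Set.indicator_of_notMem hx]; simp)
        (fun x => by
          refine tendsto_const_nhds.congr' ?_
          filter_upwards [eventually_ge_atTop ⌈|κ x|⌉₊] with N hN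
          rw [Set.indicator_of_mem]
          exact (Nat.le_ceil _).trans (Nat.cast_le.2 hN)) ψ
      rw [hμ.op_one] at h3
      refine h3.congr fun n => ?_
      rw [← hzR, hμ.op_mul_apply hz (hf n)]
      refine hμ.op_apply_congr (.indicator_one (hms n)) (hz.mul (hf n)) ?_
      filter_upwards [ae_inv_eq_of_isResolventAt hH hR hμ hz hzR ψ] with x hx
      by_cases hx' : |κ x| ≤ n
      · rw [hfin n x hx', Set.indicator_of_mem (s := {x | |κ x| ≤ n}) hx', hx]
      · rw [hfout n x hx', Set.indicator_of_notMem (s := {x | |κ x| ≤ n}) hx', mul_zero]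
    rw [tendsto_nhds_unique h2 h1]
    exact (hR.1 η).1

theorem inner_apply_eq_integral (hH : IsSelfAdjoint H) (hR : IsResolventAt H Complex.I R)
    (hμ : IsSpectralFamily μ) (hz : BddMeas z) (hzR : opIntegral μ z = R) (ψ : H.domain) :
    ⟪(ψ : 𝓗), H ψ⟫_ℂ = ∫ x, ((z x)⁻¹.re : ℂ) ∂(μ ψ) := by
  obtain ⟨η, hη, -⟩ := hR.mem_range ψ
  obtain ⟨hd, he⟩ := hR.apply_eq η
  have e : ψ = ⟨R η, hd⟩ := Subtype.ext hη.symm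
  rw [e, he]
  change ⟪R η, η + Complex.I • R η⟫_ℂ = ∫ x, ((z x)⁻¹.re : ℂ) ∂(μ (R η))
  rw [← hzR, hμ.measure_op_apply hz, integral_withDensity_eq_integral_toReal_smul
    (hz.measurable.norm.pow_const 2).ennreal_ofReal (ae_of_all _ fun _ => ENNReal.ofReal_lt_top),
    inner_add_right, inner_smul_right, hμ.inner_op_left hz, hμ.inner_op_left hz,
    hμ.op_mul_apply hz.conj hz, hμ.isIntegralOf hz.conj, hμ.isIntegralOf (hz.conj.mul hz),
    ← integral_const_mul]
  have := hμ.isFiniteMeasure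
  rw [← integral_add (hz.conj.integrable _) (((hz.conj.mul hz).const_mul _).integrable _)]
  refine integral_congr_ae ?_
  filter_upwards [ae_inv_eq_of_isResolventAt hH hR hμ hz hzR η] with x hx
  rw [ENNReal.toReal_ofReal (by positivity), Complex.real_smul, ← Complex.normSq_eq_norm_sq,
    Complex.normSq_eq_conj_mul_self, ← Complex.star_def]
  -- The integrands agree because z̄ + i|z|² = κ|z|².
  linear_combination (-star (z x)) * hx

/-- The **spectral theorem** for unbounded self-adjoint operators. -/
theorem exists_represents (hH : IsSelfAdjoint H) :
    ∃ E : ProjectionValuedMeasure 𝓗, E.Represents H := by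
  obtain ⟨R, hR⟩ := exists_isResolventAt hH Complex.conj_I Complex.I_mul_I
  have hn := hR.isStarNormal hH Complex.conj_I Complex.I_mul_I
  obtain ⟨μ, hμ, hΦ⟩ := exists_isSpectralFamily_of_starAlgHom (cfcHom (R := ℂ) hn)
  let z : spectrum ℂ R → ℂ := fun x => x
  have hz : BddMeas z := by
    refine ⟨measurable_subtype_coe, ‖R‖ * ‖(1 : 𝓗 →L[ℂ] 𝓗)‖, fun x => ?_⟩
    exact spectrum.norm_le_norm_mul_of_mem x.2
  have hzR : opIntegral μ z = R := by
    refine hμ.op_eq ?_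
    have := hΦ ((ContinuousMap.id ℂ).restrict (spectrum ℂ R))
    rwa [cfcHom_id hn] at this
  have hκ : Measurable fun x => (z x)⁻¹.re := Complex.measurable_re.comp hz.measurable.inv
  refine ⟨hμ.pvm _ hκ, fun ψ => ?_, fun ψ => ?_⟩
  · rw [hμ.pvm_measure, integrable_map_measure
      (by fun_prop) hκ.aemeasurable,
      integrable_sq_iff_mem_domain hH hR hμ hz hzR]
    rfl
  · rw [hμ.pvm_measure, integral_map hκ.aemeasurable
      Complex.measurable_ofReal.aestronglyMeasurable,
      inner_apply_eq_integral hH hR hμ hz hzR]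

end ProjectionValuedMeasure

/-! ### The chosen spectral measure and the unitary group. -/

namespace LinearPMap

variable {𝓗 : Type*} [NormedAddCommGroup 𝓗] [InnerProductSpace ℂ 𝓗] [CompleteSpace 𝓗]
  {H : 𝓗 →ₗ.[ℂ] 𝓗}

theorem spectralMeasure_represents (hH : IsSelfAdjoint H) : H.spectralMeasure.Represents H :=
  Classical.epsilon_spec (ProjectionValuedMeasure.exists_represents hH)

theorem borelCalculus_eq_opIntegral (H : 𝓗 →ₗ.[ℂ] 𝓗) (f : ℝ → ℂ) :
    H.borelCalculus f = opIntegral H.spectralMeasure.measure f := rfl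

theorem norm_sub_I_inv_le (x : ℝ) : ‖((x : ℂ) - Complex.I)⁻¹‖ ≤ 1 ∧
    |x| * ‖((x : ℂ) - Complex.I)⁻¹‖ ≤ 1 := by
  have h1 : 1 ≤ ‖(x : ℂ) - Complex.I‖ := by
    simpa using Complex.abs_im_le_norm ((x : ℂ) - Complex.I)
  have h2 : |x| ≤ ‖(x : ℂ) - Complex.I‖ := by
    simpa using Complex.abs_re_le_norm ((x : ℂ) - Complex.I)
  rw [norm_inv]
  exact ⟨inv_le_one_of_one_le₀ h1, mul_inv_le_one_of_le₀ h2 (norm_nonneg _)⟩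

theorem ofReal_sub_I_ne_zero (x : ℝ) : (x : ℂ) - Complex.I ≠ 0 := fun h => by
  simpa using congrArg Complex.im h

theorem bddMeas_sub_I_inv : BddMeas fun x : ℝ => ((x : ℂ) - Complex.I)⁻¹ :=
  ⟨(Complex.measurable_ofReal.sub measurable_const).inv, 1, fun x => (norm_sub_I_inv_le x).1⟩

theorem bddMeas_ofReal_mul_sub_I_inv : BddMeas fun x : ℝ => (x : ℂ) * ((x : ℂ) - Complex.I)⁻¹ :=
  ⟨Complex.measurable_ofReal.mul bddMeas_sub_I_inv.measurable, 1, fun x => by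
    rw [norm_mul, Complex.norm_real]
    exact (norm_sub_I_inv_le x).2⟩

/-- The chosen measure is known only through the domain and diagonal form of H. With r(x) = (x -
i)⁻¹ and K = (H - i)r(H) - 1, the diagonal form gives ⟨r(H)η, Kη⟩ = 0, so r(H)*K = 0 by
polarization. As r̄ never vanishes, r(H)* is injective and K = 0. -/
theorem opIntegral_sub_I_inv (hH : IsSelfAdjoint H) {R : 𝓗 →L[ℂ] 𝓗}
    (hR : IsResolventAt H Complex.I R) :
    H.borelCalculus (fun x => ((x : ℂ) - Complex.I)⁻¹) = R := by
  rw [borelCalculus_eq_opIntegral]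
  have hE := spectralMeasure_represents hH
  have hμ := H.spectralMeasure.isSpectralFamily
  set μ := H.spectralMeasure.measure with hμdef
  have hb := bddMeas_sub_I_inv
  set r : ℝ → ℂ := fun x => ((x : ℂ) - Complex.I)⁻¹
  have hdens : Measurable fun x => ENNReal.ofReal (‖r x‖ ^ 2) :=
    (hb.measurable.norm.pow_const 2).ennreal_ofReal
  have hfin := hμ.isFiniteMeasure
  have hdom : ∀ η, opIntegral μ r η ∈ H.domain := fun η => by
    rw [hE.1, ← hμdef, hμ.measure_op_apply hb, integrable_withDensity_iff hdens
      (ae_of_all _ fun _ => ENNReal.ofReal_lt_top)]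
    refine Integrable.of_bound (C := 1) ((measurable_id.pow_const 2).mul
      hdens.ennreal_toReal).aestronglyMeasurable (ae_of_all _ fun x => ?_)
    rw [ENNReal.toReal_ofReal (by positivity), ← mul_pow, Real.norm_of_nonneg (by positivity),
      sq_le_one_iff_abs_le_one, abs_mul, abs_norm]
    exact (norm_sub_I_inv_le x).2
  let K : 𝓗 →ₗ[ℂ] 𝓗 := H.toFun ∘ₗ (LinearMap.codRestrict H.domain
    (opIntegral μ r).toLinearMap hdom) - LinearMap.id - Complex.I • (opIntegral μ r).toLinearMap
  have hK : ∀ η, K η = H ⟨opIntegral μ r η, hdom η⟩ - η - Complex.I • opIntegral μ r η :=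
    fun _ => rfl
  have hKzero : ∀ η, ⟪opIntegral μ r η, K η⟫_ℂ = 0 := fun η => by
    have h1 := hE.2 ⟨_, hdom η⟩
    rw [← hμdef, hμ.measure_op_apply hb, integral_withDensity_eq_integral_toReal_smul hdens
      (ae_of_all _ fun _ => ENNReal.ofReal_lt_top)] at h1
    rw [hK, inner_sub_right, inner_sub_right, inner_smul_right, h1, hμ.inner_op_left hb,
      hμ.inner_op_left hb, hμ.op_mul_apply hb.conj hb, hμ.isIntegralOf hb.conj,
      hμ.isIntegralOf (hb.conj.mul hb), ← integral_const_mul, sub_sub, sub_eq_zero,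
      ← integral_add (hb.conj.integrable _) (((hb.conj.mul hb).const_mul _).integrable _)]
    refine integral_congr_ae (ae_of_all _ fun x => ?_)
    have hx : r x * (x - Complex.I) = 1 := inv_mul_cancel₀ (ofReal_sub_I_ne_zero x)
    change (ENNReal.ofReal (‖r x‖ ^ 2)).toReal • (x : ℂ) =
      star (r x) + Complex.I * (star (r x) * r x)
    rw [ENNReal.toReal_ofReal (by positivity), Complex.real_smul, ← Complex.normSq_eq_norm_sq,
      Complex.normSq_eq_conj_mul_self, ← Complex.star_def]
    linear_combination (star (r x)) * hx
  have hKK : ∀ η, K η = 0 := fun η => by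
    let T : 𝓗 →ₗ[ℂ] 𝓗 := (ContinuousLinearMap.adjoint (opIntegral μ r)).toLinearMap ∘ₗ K
    have hT : T = 0 := (inner_map_self_eq_zero T).1 fun x => by
      rw [← inner_conj_symm]
      change starRingEnd ℂ ⟪x, ContinuousLinearMap.adjoint (opIntegral μ r) (K x)⟫_ℂ = 0
      rw [ContinuousLinearMap.adjoint_inner_right, hKzero, _root_.map_zero]
    have h1 : ContinuousLinearMap.adjoint (opIntegral μ r) (K η) = 0 :=
      congrArg (fun S : 𝓗 →ₗ[ℂ] 𝓗 => S η) hT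
    rw [hμ.op_adjoint hb] at h1
    refine hμ.eq_zero_of_measure_eq_zero (ae_eq_bot.1 ?_)
    have h2 := hμ.ae_eq_zero_of_op_apply_eq_zero hb.conj h1
    refine eventually_false_iff_eq_bot.1 ?_
    filter_upwards [h2] with x hx
    exact inv_ne_zero (ofReal_sub_I_ne_zero x) (star_eq_zero.1 hx)
  ext η
  have h1 := hR.2 ⟨_, hdom η⟩
  have h2 := hKK η
  rw [hK, sub_right_comm, sub_eq_zero] at h2
  rw [h2] at h1
  exact h1.symm

theorem bddMeas_exp (t : ℝ) : BddMeas fun x : ℝ => Complex.exp (Complex.I * t * x) :=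
  ⟨by fun_prop, 1, fun x => by
    have : Complex.I * t * x = ((t * x : ℝ) : ℂ) * Complex.I := by push_cast; ring
    rw [this, Complex.norm_exp_ofReal_mul_I]⟩

theorem expI_eq_opIntegral (H : 𝓗 →ₗ.[ℂ] 𝓗) (t : ℝ) :
    H.expI t = opIntegral H.spectralMeasure.measure fun x => Complex.exp (Complex.I * t * x) := rfl

theorem expI_zero (H : 𝓗 →ₗ.[ℂ] 𝓗) : H.expI 0 = 1 := by
  rw [expI_eq_opIntegral, ← H.spectralMeasure.isSpectralFamily.op_one]
  simp

theorem expI_apply_expI (H : 𝓗 →ₗ.[ℂ] 𝓗) (s t : ℝ) (ψ : 𝓗) :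
    H.expI s (H.expI t ψ) = H.expI (s + t) ψ := by
  simp only [expI_eq_opIntegral]
  rw [H.spectralMeasure.isSpectralFamily.op_mul_apply (bddMeas_exp s) (bddMeas_exp t)]
  congr 2
  ext x
  rw [← Complex.exp_add]
  congr 1
  push_cast
  ring

theorem inner_expI_left (H : 𝓗 →ₗ.[ℂ] 𝓗) (t : ℝ) (φ ψ : 𝓗) :
    ⟪H.expI t φ, ψ⟫_ℂ = ⟪φ, H.expI (-t) ψ⟫_ℂ := by
  simp only [expI_eq_opIntegral]
  rw [H.spectralMeasure.isSpectralFamily.inner_op_left (bddMeas_exp t)]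
  congr 3
  ext x
  rw [Complex.star_def, ← Complex.exp_conj]
  simp

theorem norm_expI_apply (H : 𝓗 →ₗ.[ℂ] 𝓗) (t : ℝ) (ψ : 𝓗) : ‖H.expI t ψ‖ = ‖ψ‖ := by
  have h : ⟪H.expI t ψ, H.expI t ψ⟫_ℂ = ⟪ψ, ψ⟫_ℂ := by
    rw [inner_expI_left, expI_apply_expI, neg_add_cancel, expI_zero]
    rfl
  rw [inner_self_eq_norm_sq_to_K, inner_self_eq_norm_sq_to_K] at h
  have h' : ‖H.expI t ψ‖ ^ 2 = ‖ψ‖ ^ 2 := by exact_mod_cast h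
  exact (sq_eq_sq₀ (norm_nonneg _) (norm_nonneg _)).1 h'

theorem continuous_expI_apply (H : 𝓗 →ₗ.[ℂ] 𝓗) (ψ : 𝓗) : Continuous fun t => H.expI t ψ := by
  refine continuous_iff_continuousAt.2 fun t => ?_
  refine H.spectralMeasure.isSpectralFamily.tendsto_op (C := 1) bddMeas_exp (bddMeas_exp t)
    (Eventually.of_forall fun s x => ?_) (fun x => ?_) ψ
  · have : Complex.I * s * x = ((s * x : ℝ) : ℂ) * Complex.I := by push_cast; ring
    rw [this, Complex.norm_exp_ofReal_mul_I]
  · have : Continuous fun s : ℝ => Complex.exp (Complex.I * s * x) := by fun_prop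
    exact this.tendsto t

theorem expI_comm_borelCalculus (H : 𝓗 →ₗ.[ℂ] 𝓗) (t : ℝ) {f : ℝ → ℂ} (hf : BddMeas f) (ψ : 𝓗) :
    H.expI t (H.borelCalculus f ψ) = H.borelCalculus f (H.expI t ψ) :=
  H.spectralMeasure.isSpectralFamily.op_comm (bddMeas_exp t) hf ψ

/-- The estimate |e^{ihx} - 1| ≤ |hx| bounds the difference quotients by |x f(x)|, hence uniformly,
so pointwise differentiation passes to the strong limit. -/
theorem hasDerivAt_expI_borelCalculus (H : 𝓗 →ₗ.[ℂ] 𝓗) {f : ℝ → ℂ} (hf : BddMeas f)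
    (hxf : BddMeas fun x : ℝ => (x : ℂ) * f x) (t : ℝ) (η : 𝓗) :
    HasDerivAt (fun s => H.expI s (H.borelCalculus f η))
      (Complex.I • H.expI t (H.borelCalculus (fun x => (x : ℂ) * f x) η)) t := by
  have hμ := H.spectralMeasure.isSpectralFamily
  rw [hasDerivAt_iff_tendsto_slope_zero]
  obtain ⟨C, hC⟩ := hxf.bounded
  have hlim : Complex.I • H.expI t (H.borelCalculus (fun x => (x : ℂ) * f x) η) =
      opIntegral H.spectralMeasure.measure (fun x : ℝ => Complex.I *
        (Complex.exp (Complex.I * t * x) * ((x : ℂ) * f x))) η := by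
    rw [hμ.op_const_mul _ ((bddMeas_exp t).mul hxf), hμ.op_mul (bddMeas_exp t) hxf]
    rfl
  rw [hlim]
  have hF : ∀ h : ℝ, BddMeas fun x : ℝ => ((h⁻¹ : ℝ) : ℂ) *
      (Complex.exp (Complex.I * (t + h : ℝ) * x) * f x - Complex.exp (Complex.I * t * x) * f x) :=
    fun h => (((bddMeas_exp (t + h)).mul hf).sub ((bddMeas_exp t).mul hf)).const_mul _
  have key := hμ.tendsto_op (l := 𝓝[≠] (0 : ℝ)) (C := C) hF
    (((bddMeas_exp t).mul hxf).const_mul Complex.I)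
    (Eventually.of_forall fun h x => ?_) (fun x => ?_) η
  · refine key.congr fun h => ?_
    rw [hμ.op_const_mul _ (((bddMeas_exp (t + h)).mul hf).sub ((bddMeas_exp t).mul hf)),
      hμ.op_sub ((bddMeas_exp (t + h)).mul hf) ((bddMeas_exp t).mul hf),
      hμ.op_mul (bddMeas_exp _) hf, hμ.op_mul (bddMeas_exp _) hf]
    simp only [_root_.smul_apply, Complex.coe_smul]
    rfl
  · have e : ((h⁻¹ : ℝ) : ℂ) * (Complex.exp (Complex.I * (t + h : ℝ) * x) * f x -
        Complex.exp (Complex.I * t * x) * f x) = Complex.exp (((t * x : ℝ) : ℂ) * Complex.I) *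
        (((h⁻¹ : ℝ) : ℂ) * (Complex.exp (Complex.I * (h * x : ℝ)) - 1)) * f x := by
      have e1 : Complex.I * (t + h : ℝ) * x = ((t * x : ℝ) : ℂ) * Complex.I +
        Complex.I * (h * x : ℝ) := by push_cast; ring
      have e2 : Complex.I * t * x = ((t * x : ℝ) : ℂ) * Complex.I := by push_cast; ring
      rw [e1, e2, Complex.exp_add]
      ring
    rw [e, norm_mul, norm_mul, Complex.norm_exp_ofReal_mul_I, one_mul]
    refine le_trans ?_ (hC x)
    rw [norm_mul ((x : ℂ))]
    gcongr
    rw [norm_mul, Complex.norm_real, Complex.norm_real]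
    refine (mul_le_mul_of_nonneg_left (Real.norm_exp_I_mul_ofReal_sub_one_le (x := h * x))
      (norm_nonneg _)).trans ?_
    rw [norm_mul, ← mul_assoc, norm_inv]
    exact mul_le_of_le_one_left (norm_nonneg _) inv_mul_le_one
  · have hd : HasDerivAt (fun s : ℝ => Complex.exp (Complex.I * s * x) * f x)
        (Complex.I * (Complex.exp (Complex.I * t * x) * ((x : ℂ) * f x))) t := by
      have h1 : HasDerivAt (fun s : ℝ => Complex.I * (s : ℂ) * x) (Complex.I * 1 * x) t :=
        ((Complex.ofRealCLM.hasDerivAt (x := t)).const_mul Complex.I).mul_const (x : ℂ)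
      refine ((h1.cexp).mul_const (f x)).congr_deriv ?_
      ring
    rw [hasDerivAt_iff_tendsto_slope_zero] at hd
    refine hd.congr fun h => ?_
    rw [Complex.real_smul]

theorem isResolventAt_resolventAt (hH : IsSelfAdjoint H) :
    IsResolventAt H Complex.I (H.resolventAt Complex.I) :=
  Classical.epsilon_spec (exists_isResolventAt hH Complex.conj_I Complex.I_mul_I)

theorem ofReal_mul_sub_I_inv (x : ℝ) : (x : ℂ) * ((x : ℂ) - Complex.I)⁻¹ =
    1 + Complex.I * ((x : ℂ) - Complex.I)⁻¹ := by
  have hx : ((x : ℂ) - Complex.I)⁻¹ * (x - Complex.I) = 1 :=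
    inv_mul_cancel₀ (ofReal_sub_I_ne_zero x)
  linear_combination hx

theorem hasDerivAt_expI_resolventAt (hH : IsSelfAdjoint H) (t : ℝ) (η : 𝓗) :
    HasDerivAt (fun s => H.expI s (H.resolventAt Complex.I η))
      (Complex.I • H.expI t (η + Complex.I • H.resolventAt Complex.I η)) t := by
  have h := H.hasDerivAt_expI_borelCalculus bddMeas_sub_I_inv bddMeas_ofReal_mul_sub_I_inv t η
  have hμ := H.spectralMeasure.isSpectralFamily
  have e : H.borelCalculus (fun x => (x : ℂ) * ((x : ℂ) - Complex.I)⁻¹) =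
      1 + Complex.I • H.borelCalculus fun x => ((x : ℂ) - Complex.I)⁻¹ := by
    simp only [ofReal_mul_sub_I_inv, borelCalculus_eq_opIntegral]
    rw [hμ.op_add (.const 1) (bddMeas_sub_I_inv.const_mul _), hμ.op_one,
      hμ.op_const_mul _ bddMeas_sub_I_inv]
  rw [e, opIntegral_sub_I_inv hH (isResolventAt_resolventAt hH)] at h
  exact h

theorem hasDerivAt_expI (hH : IsSelfAdjoint H) (t : ℝ) (ψ : H.domain) :
    HasDerivAt (fun s => H.expI s (ψ : 𝓗)) (Complex.I • H.expI t (H ψ)) t := by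
  have hR := isResolventAt_resolventAt hH
  have h := hasDerivAt_expI_resolventAt hH t (H ψ - Complex.I • (ψ : 𝓗))
  rw [hR.2 ψ, sub_add_cancel] at h
  exact h

end LinearPMap

/-! ### Commutators through difference quotients, and the uniform bound. -/

namespace LinearPMap

variable {𝓗 : Type*} [NormedAddCommGroup 𝓗] [InnerProductSpace ℂ 𝓗] [CompleteSpace 𝓗]
  {H A : 𝓗 →ₗ.[ℂ] 𝓗}

/-- The bounded approximation `(e^{iτA} - 1) / (iτ)` of a self-adjoint operator `A`. -/
noncomputable def diffQuotient (A : 𝓗 →ₗ.[ℂ] 𝓗) (τ : ℝ) : 𝓗 →L[ℂ] 𝓗 :=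
  (-Complex.I * (τ⁻¹ : ℝ)) • (A.expI τ - 1)

theorem diffQuotient_apply (A : 𝓗 →ₗ.[ℂ] 𝓗) (τ : ℝ) (ψ : 𝓗) :
    A.diffQuotient τ ψ = (-Complex.I) • (τ⁻¹ • (A.expI τ ψ - ψ)) := by
  rw [← Complex.coe_smul, smul_smul]
  rfl

theorem inner_diffQuotient (A : 𝓗 →ₗ.[ℂ] 𝓗) (τ : ℝ) (φ ψ : 𝓗) :
    ⟪A.diffQuotient (-τ) φ, ψ⟫_ℂ = ⟪φ, A.diffQuotient τ ψ⟫_ℂ := by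
  rw [diffQuotient_apply, diffQuotient_apply, ← Complex.coe_smul, ← Complex.coe_smul,
    inner_smul_left, inner_smul_left, inner_smul_right, inner_smul_right, inner_sub_left,
    inner_sub_right, inner_expI_left, neg_neg]
  simp

theorem tendsto_diffQuotient (hA : IsSelfAdjoint A) (ψ : A.domain) :
    Tendsto (fun τ => A.diffQuotient τ (ψ : 𝓗)) (𝓝[≠] 0) (𝓝 (A ψ)) := by
  have h := hasDerivAt_expI hA 0 ψ
  rw [hasDerivAt_iff_tendsto_slope_zero] at h
  have h2 := h.const_smul (-Complex.I)
  rw [expI_zero, one_apply_eq_self, smul_smul, neg_mul, Complex.I_mul_I, neg_neg, one_smul] at h2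
  refine h2.congr fun τ => ?_
  rw [diffQuotient_apply, zero_add]

/-- The adjoint of the quotient at τ is the quotient at -τ, so limits in the left slot run along -τ.
-/
theorem tendsto_neg_punctured : Tendsto (fun τ : ℝ => -τ) (𝓝[≠] 0) (𝓝[≠] 0) := by
  refine tendsto_nhdsWithin_of_tendsto_nhds_of_eventually_within _ ?_ ?_
  · have : Tendsto (fun τ : ℝ => -τ) (𝓝 0) (𝓝 (-0)) := tendsto_id.neg
    rw [neg_zero] at this
    exact this.mono_left nhdsWithin_le_nhds
  · filter_upwards [self_mem_nhdsWithin] with τ hτ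
    exact neg_ne_zero.2 hτ

theorem exists_apply_eq_of_tendsto_diffQuotient (hA : IsSelfAdjoint A) {x w : 𝓗}
    (h : Tendsto (fun τ => A.diffQuotient τ x) (𝓝[≠] 0) (𝓝 w)) :
    ∃ hx : x ∈ A.domain, A ⟨x, hx⟩ = w := by
  refine exists_apply_eq_of_isSelfAdjoint hA fun φ => ?_
  refine tendsto_nhds_unique
    (((tendsto_diffQuotient hA φ).comp tendsto_neg_punctured).inner tendsto_const_nhds)
    ((tendsto_const_nhds.inner h).congr fun τ => ?_)
  rw [← inner_diffQuotient]
  rfl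

/-- Up to the factor i, the commutator is e^{iτA} applied to the difference quotient of t ↦
e^{-itA}Se^{itA}ψ at 0. The isometries e^{iτA} tend strongly to 1 and leave the limit unchanged. -/
theorem exists_tendsto_commutator_diffQuotient {S : 𝓗 →L[ℂ] 𝓗} (hS : A.IsOfClass 1 S) (ψ : 𝓗) :
    ∃ w, Tendsto (fun τ => A.diffQuotient τ (S ψ) - S (A.diffQuotient τ ψ)) (𝓝[≠] 0) (𝓝 w) := by
  have hd : HasDerivAt _ _ (0 : ℝ) :=
    ((hS ψ).differentiable (by norm_num)).differentiableAt.hasDerivAt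
  rw [hasDerivAt_iff_tendsto_slope_zero] at hd
  set k := deriv (fun t : ℝ => A.expI (-t) (S (A.expI t ψ))) 0
  set q : ℝ → 𝓗 := fun τ => τ⁻¹ • (A.expI (-(0 + τ)) (S (A.expI (0 + τ) ψ)) -
    A.expI (-0) (S (A.expI 0 ψ))) with hq
  have hlim : Tendsto (fun τ => A.expI τ (q τ)) (𝓝[≠] 0) (𝓝 k) := by
    rw [tendsto_iff_norm_sub_tendsto_zero] at hd ⊢
    have h2 : Tendsto (fun τ => ‖A.expI τ k - k‖) (𝓝[≠] 0) (𝓝 0) := by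
      have := ((continuous_expI_apply A k).tendsto 0).mono_left
        (nhdsWithin_le_nhds (s := {0}ᶜ))
      rw [expI_zero, tendsto_iff_norm_sub_tendsto_zero] at this
      exact this
    refine squeeze_zero (fun _ => norm_nonneg _) (fun τ => ?_) (by simpa using hd.add h2)
    have e : A.expI τ (q τ) - k = A.expI τ (q τ - k) + (A.expI τ k - k) := by
      rw [_root_.map_sub]; abel
    rw [e]
    refine (norm_add_le _ _).trans ?_
    rw [norm_expI_apply]
  refine ⟨Complex.I • k, (hlim.const_smul Complex.I).congr fun τ => ?_⟩
  have e : A.expI τ (q τ) = τ⁻¹ • (S (A.expI τ ψ) - A.expI τ (S ψ)) := by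
    simp only [hq, zero_add, neg_zero, expI_zero, one_apply_eq_self]
    rw [← Complex.coe_smul, _root_.map_smul, _root_.map_sub, expI_apply_expI, add_neg_cancel,
      expI_zero, one_apply_eq_self, Complex.coe_smul]
  rw [e, diffQuotient_apply, diffQuotient_apply, _root_.map_smul, ← Complex.coe_smul,
    ← Complex.coe_smul, ← Complex.coe_smul, _root_.map_smul, _root_.map_sub]
  simp only [smul_sub, neg_smul]
  abel

section Commutator

variable (H A)

/-- The bounded approximation of the sandwiched commutator, with `A` replaced by its difference
quotient. -/
noncomputable def approxCommutator (τ : ℝ) : 𝓗 →L[ℂ] 𝓗 :=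
  Complex.I • (star (1 + Complex.I • H.resolventAt Complex.I) * A.diffQuotient τ *
    H.resolventAt Complex.I - star (H.resolventAt Complex.I) * A.diffQuotient τ *
    (1 + Complex.I • H.resolventAt Complex.I))

theorem inner_approxCommutator (τ : ℝ) (φ ψ : 𝓗) :
    ⟪φ, approxCommutator H A τ ψ⟫_ℂ = Complex.I *
      (⟪φ + Complex.I • H.resolventAt Complex.I φ, A.diffQuotient τ (H.resolventAt Complex.I ψ)⟫_ℂ -
      ⟪H.resolventAt Complex.I φ,
        A.diffQuotient τ (ψ + Complex.I • H.resolventAt Complex.I ψ)⟫_ℂ) := by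
  have e : approxCommutator H A τ ψ = Complex.I •
    (ContinuousLinearMap.adjoint (1 + Complex.I • H.resolventAt Complex.I)
      (A.diffQuotient τ (H.resolventAt Complex.I ψ)) -
      ContinuousLinearMap.adjoint (H.resolventAt Complex.I)
        (A.diffQuotient τ (ψ + Complex.I • H.resolventAt Complex.I ψ))) := rfl
  rw [e, inner_smul_right, inner_sub_right, ContinuousLinearMap.adjoint_inner_right,
    ContinuousLinearMap.adjoint_inner_right]
  rfl

variable {H A}

/-- The identity 2iR*R = R - R* factors the expression as a τ-independent operator times [Q, R],
with Q the difference quotient; its limit is then governed by R ∈ C¹(A) alone. -/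
theorem approxCommutator_eq (hH : IsSelfAdjoint H) (τ : ℝ) : approxCommutator H A τ =
    Complex.I • ((1 - (2 * Complex.I) • star (H.resolventAt Complex.I)) *
      (A.diffQuotient τ * H.resolventAt Complex.I - H.resolventAt Complex.I * A.diffQuotient τ)) := by
  have h := (isResolventAt_resolventAt hH).sub_adjoint hH Complex.conj_I
  rw [approxCommutator]
  set R := H.resolventAt Complex.I
  set Q := A.diffQuotient τ
  have h' : (2 * Complex.I) • (star R * R * Q) = R * Q - star R * Q := by
    rw [← sub_mul, h, smul_mul_assoc]
  congr 1
  rw [star_add, star_one, star_smul, Complex.star_def, Complex.conj_I]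
  simp only [add_mul, mul_add, sub_mul, mul_sub, one_mul, mul_one, smul_mul_assoc, mul_smul_comm,
    ← mul_assoc]
  rw [h', two_mul, add_smul, neg_smul]
  abel

theorem exists_tendsto_approxCommutator (hH : IsSelfAdjoint H)
    (hHA : A.IsOfClass 1 (H.resolventAt Complex.I)) :
    ∃ B : 𝓗 →L[ℂ] 𝓗, ∀ ψ, Tendsto (fun τ => approxCommutator H A τ ψ) (𝓝[≠] 0) (𝓝 (B ψ)) := by
  have h : ∀ ψ, ∃ w, Tendsto (fun τ => approxCommutator H A τ ψ) (𝓝[≠] 0) (𝓝 w) := fun ψ => by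
    obtain ⟨w, hw⟩ := exists_tendsto_commutator_diffQuotient hHA ψ
    refine ⟨Complex.I • (1 - (2 * Complex.I) • star (H.resolventAt Complex.I)) w, ?_⟩
    refine ((((1 - (2 * Complex.I) • star (H.resolventAt Complex.I)).continuous.tendsto w).comp
      hw).const_smul Complex.I).congr fun τ => ?_
    rw [approxCommutator_eq hH]
    rfl
  choose f hf using h
  exact ⟨continuousLinearMapOfTendsto (fun τ => approxCommutator H A τ) (tendsto_pi_nhds.2 hf), hf⟩

/-- QRψ = [Q, R]ψ + RQψ, and both terms converge for ψ in dom(A). -/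
theorem resolventAt_mem_domain (hA : IsSelfAdjoint A)
    (hHA : A.IsOfClass 1 (H.resolventAt Complex.I)) (ψ : A.domain) :
    H.resolventAt Complex.I ψ ∈ A.domain := by
  obtain ⟨w, hw⟩ := exists_tendsto_commutator_diffQuotient hHA (ψ : 𝓗)
  have h2 := ((H.resolventAt Complex.I).continuous.tendsto _).comp (tendsto_diffQuotient hA ψ)
  refine (exists_apply_eq_of_tendsto_diffQuotient hA ((hw.add h2).congr fun τ => ?_)).1
  exact sub_add_cancel _ _

/-- The strong limit satisfies the defining form identity. That identity has one solution, because
(H - i) maps dom(H) ∩ dom(A) onto a set containing the dense dom(A). -/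
theorem tendsto_approxCommutator_sandwichedCommutator (hH : IsSelfAdjoint H)
    (hA : IsSelfAdjoint A) (hHA : A.IsOfClass 1 (H.resolventAt Complex.I)) (ψ : 𝓗) :
    Tendsto (fun τ => approxCommutator H A τ ψ) (𝓝[≠] 0) (𝓝 (H.sandwichedCommutator A ψ)) := by
  have hR := isResolventAt_resolventAt hH
  obtain ⟨B, hB⟩ := exists_tendsto_approxCommutator hH hHA
  have hform : ∀ φ ψ : ↥(H.domain ⊓ A.domain),
      ⟪H ⟨φ, φ.2.1⟩ - Complex.I • (φ : 𝓗), B (H ⟨ψ, ψ.2.1⟩ - Complex.I • (ψ : 𝓗))⟫_ℂ =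
        commutatorForm H A φ ψ := fun φ ψ => by
    refine tendsto_nhds_unique (tendsto_const_nhds.inner (hB _)) ?_
    have h1 := (tendsto_const_nhds (x := H ⟨φ, φ.2.1⟩)).inner
      (𝕜 := ℂ) (tendsto_diffQuotient hA ⟨ψ, ψ.2.2⟩)
    have h2 := ((tendsto_diffQuotient hA ⟨φ, φ.2.2⟩).comp tendsto_neg_punctured).inner
      (𝕜 := ℂ) (tendsto_const_nhds (x := H ⟨ψ, ψ.2.1⟩))
    refine ((h1.sub h2).const_mul Complex.I).congr fun τ => ?_
    rw [inner_approxCommutator, hR.2 ⟨φ, φ.2.1⟩, hR.2 ⟨ψ, ψ.2.1⟩, sub_add_cancel, sub_add_cancel,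
      ← inner_diffQuotient A τ φ]
    rfl
  have hC : ∀ φ ψ : ↥(H.domain ⊓ A.domain), ⟪H ⟨φ, φ.2.1⟩ - Complex.I • (φ : 𝓗),
      H.sandwichedCommutator A (H ⟨ψ, ψ.2.1⟩ - Complex.I • (ψ : 𝓗))⟫_ℂ =
        commutatorForm H A φ ψ :=
    Classical.epsilon_spec (p := fun B : 𝓗 →L[ℂ] 𝓗 => ∀ φ ψ : ↥(H.domain ⊓ A.domain),
      ⟪H ⟨φ, φ.2.1⟩ - Complex.I • (φ : 𝓗), B (H ⟨ψ, ψ.2.1⟩ - Complex.I • (ψ : 𝓗))⟫_ℂ =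
        commutatorForm H A φ ψ) ⟨B, hform⟩
  have hdom : ∀ f : A.domain, ∃ φ : ↥(H.domain ⊓ A.domain),
      H ⟨φ, φ.2.1⟩ - Complex.I • (φ : 𝓗) = f := fun f => by
    obtain ⟨h1, h2⟩ := hR.1 f
    exact ⟨⟨_, h1, resolventAt_mem_domain hA hHA f⟩, h2⟩
  have heq : ∀ ψ, B ψ = H.sandwichedCommutator A ψ := by
    refine fun ψ => congrFun (Continuous.ext_on hA.dense_domain B.continuous
      (H.sandwichedCommutator A).continuous fun h hh => ?_) ψ
    refine hA.dense_domain.eq_of_inner_right ℂ fun f hf => ?_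
    obtain ⟨φ, hφ⟩ := hdom ⟨f, hf⟩
    obtain ⟨χ, hχ⟩ := hdom ⟨h, hh⟩
    have e1 := hform φ χ
    have e2 := hC φ χ
    rw [hφ, hχ] at e1 e2
    rw [e1, e2]
  rw [← heq]
  exact hB ψ

theorem continuous_expI_apply_comp (H : 𝓗 →ₗ.[ℂ] 𝓗) {Y : Type*} [TopologicalSpace Y] {u : Y → ℝ}
    {v : Y → 𝓗} (hu : Continuous u) (hv : Continuous v) : Continuous fun y => H.expI (u y) (v y) := by
  refine continuous_iff_continuousAt.2 fun y₀ => ?_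
  rw [ContinuousAt, tendsto_iff_norm_sub_tendsto_zero]
  have h1 := tendsto_iff_norm_sub_tendsto_zero.1 (hv.tendsto y₀)
  have h2 := tendsto_iff_norm_sub_tendsto_zero.1
    (((continuous_expI_apply H (v y₀)).comp hu).tendsto y₀)
  refine squeeze_zero (fun _ => norm_nonneg _) (fun y => ?_) (by simpa using h1.add h2)
  have e : H.expI (u y) (v y) - H.expI (u y₀) (v y₀) = H.expI (u y) (v y - v y₀) +
      (H.expI (u y) (v y₀) - H.expI (u y₀) (v y₀)) := by
    rw [_root_.map_sub]; abel
  rw [e]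
  refine (norm_add_le _ _).trans ?_
  rw [norm_expI_apply]

theorem expI_comm_resolventAt (hH : IsSelfAdjoint H) (t : ℝ) (ψ : 𝓗) :
    H.expI t (H.resolventAt Complex.I ψ) = H.resolventAt Complex.I (H.expI t ψ) := by
  rw [← opIntegral_sub_I_inv hH (isResolventAt_resolventAt hH)]
  exact expI_comm_borelCalculus H t bddMeas_sub_I_inv ψ

/-- The integrand is the derivative of ⟨e^{i(t-s)H}Rφ, Q e^{-isH}Rψ⟩ in s, using HR = 1 + iR. -/
theorem integral_inner_approxCommutator (hH : IsSelfAdjoint H) (τ t : ℝ) (φ ψ : 𝓗) :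
    ∫ s in (0 : ℝ)..t, ⟪H.expI (t - s) φ, approxCommutator H A τ (H.expI (-s) ψ)⟫_ℂ =
      ⟪H.resolventAt Complex.I φ,
        A.diffQuotient τ (H.expI (-t) (H.resolventAt Complex.I ψ))⟫_ℂ -
      ⟪H.expI t (H.resolventAt Complex.I φ),
        A.diffQuotient τ (H.resolventAt Complex.I ψ)⟫_ℂ := by
  have hderiv : ∀ s, HasDerivAt (fun s => ⟪H.expI (t - s) (H.resolventAt Complex.I φ),
      A.diffQuotient τ (H.expI (-s) (H.resolventAt Complex.I ψ))⟫_ℂ)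
      ⟪H.expI (t - s) φ, approxCommutator H A τ (H.expI (-s) ψ)⟫_ℂ s := fun s => by
    have h1 := (hasDerivAt_expI_resolventAt hH (t - s) φ).scomp s ((hasDerivAt_id s).const_sub t)
    have h2 := (hasDerivAt_expI_resolventAt hH (-s) ψ).scomp s (hasDerivAt_neg s)
    have h3 := ((A.diffQuotient τ).restrictScalars ℝ).hasFDerivAt.comp_hasDerivAt s h2
    have h4 := h1.inner ℂ h3
    refine h4.congr_deriv ?_
    rw [inner_approxCommutator]
    simp only [Function.comp_apply, ContinuousLinearMap.coe_restrictScalars', neg_smul,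
      one_smul, _root_.map_neg, inner_neg_left, inner_neg_right, _root_.map_smul, inner_smul_left,
      inner_smul_right, Complex.conj_I, _root_.map_add, expI_comm_resolventAt hH]
    ring
  rw [intervalIntegral.integral_eq_sub_of_hasDerivAt (fun s _ => hderiv s)]
  · simp [expI_zero]
  · refine Continuous.intervalIntegrable ?_ _ _
    exact (continuous_expI_apply_comp H (by fun_prop) continuous_const).inner
      ((approxCommutator H A τ).continuous.comp
        (continuous_expI_apply_comp H continuous_neg continuous_const))

/-- As τ → 0 the boundary terms become ⟨ARφ, e^{-itH}Rψ⟩ - ⟨e^{itH}Rφ, ARψ⟩, bounded independently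
of t by unitarity. -/
theorem exists_norm_inner_integral_le (hH : IsSelfAdjoint H)
    (hA : IsSelfAdjoint A) (hHA : A.IsOfClass 1 (H.resolventAt Complex.I)) (φ ψ : A.domain) :
    ∃ c : ℝ, ∀ t : ℝ, ‖⟪H.expI t φ, ∫ s in (0 : ℝ)..t,
      H.expI s (H.sandwichedCommutator A (H.expI (-s) ψ))⟫_ℂ‖ ≤ c := by
  set R := H.resolventAt Complex.I
  set B := H.sandwichedCommutator A
  have hφ := resolventAt_mem_domain hA hHA φ
  have hψ := resolventAt_mem_domain hA hHA ψ
  refine ⟨‖A ⟨_, hφ⟩‖ * ‖R ψ‖ + ‖R φ‖ * ‖A ⟨_, hψ⟩‖, fun t => ?_⟩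
  have hcont : ∀ T : 𝓗 →L[ℂ] 𝓗, Continuous fun s => ⟪H.expI (t - s) φ, T (H.expI (-s) ψ)⟫_ℂ :=
    fun T => (continuous_expI_apply_comp H (by fun_prop) continuous_const).inner
      (T.continuous.comp (continuous_expI_apply_comp H continuous_neg continuous_const))
  have e1 : ⟪H.expI t φ, ∫ s in (0 : ℝ)..t, H.expI s (B (H.expI (-s) ψ))⟫_ℂ =
      ∫ s in (0 : ℝ)..t, ⟪H.expI (t - s) φ, B (H.expI (-s) ψ)⟫_ℂ := by
    have hi : IntervalIntegrable (fun s => H.expI s (B (H.expI (-s) ψ))) volume 0 t :=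
      (continuous_expI_apply_comp H continuous_id (B.continuous.comp
        (continuous_expI_apply_comp H continuous_neg continuous_const))).intervalIntegrable _ _
    have := ((innerSL ℂ (H.expI t φ)).restrictScalars ℝ).intervalIntegral_comp_comm hi
    refine this.symm.trans (intervalIntegral.integral_congr fun s _ => ?_)
    change ⟪H.expI t φ, H.expI s (B (H.expI (-s) ψ))⟫_ℂ = ⟪H.expI (t - s) φ, B (H.expI (-s) ψ)⟫_ℂ
    have e : H.expI (t - s) φ = H.expI (-s) (H.expI t φ) := by
      rw [expI_apply_expI, neg_add_eq_sub]
    rw [e, inner_expI_left H (-s), neg_neg]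
  rw [e1]
  -- Along a sequence, strong convergence gives pointwise boundedness; Banach–Steinhaus then yields
  -- the dominating constant.
  let τ : ℕ → ℝ := fun n => 1 / ((n : ℝ) + 1)
  have hτ : Tendsto τ atTop (𝓝[≠] 0) :=
    tendsto_nhdsWithin_of_tendsto_nhds_of_eventually_within _
      tendsto_one_div_add_atTop_nhds_zero_nat
      (Eventually.of_forall fun n => Nat.one_div_pos_of_nat.ne')
  have hB := fun h => (tendsto_approxCommutator_sandwichedCommutator hH hA hHA h).comp hτ
  obtain ⟨C, hC⟩ := banach_steinhaus (g := fun n => approxCommutator H A (τ n)) fun x => by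
    obtain ⟨C, hC⟩ := (hB x).norm.bddAbove_range
    exact ⟨C, fun n => hC ⟨n, rfl⟩⟩
  have hlim : Tendsto (fun n => ∫ s in (0 : ℝ)..t,
      ⟪H.expI (t - s) φ, approxCommutator H A (τ n) (H.expI (-s) ψ)⟫_ℂ) atTop
      (𝓝 (∫ s in (0 : ℝ)..t, ⟪H.expI (t - s) φ, B (H.expI (-s) ψ)⟫_ℂ)) := by
    refine intervalIntegral.tendsto_integral_filter_of_dominated_convergence
      (fun _ => ‖(φ : 𝓗)‖ * (C * ‖(ψ : 𝓗)‖))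
      (Eventually.of_forall fun n => (hcont _).aestronglyMeasurable)
      (Eventually.of_forall fun n => ae_of_all _ fun s _ => ?_) intervalIntegrable_const
      (ae_of_all _ fun s _ => tendsto_const_nhds.inner (hB _))
    refine (norm_inner_le_norm _ _).trans ?_
    rw [norm_expI_apply]
    gcongr
    refine ((approxCommutator H A (τ n)).le_opNorm _).trans ?_
    rw [norm_expI_apply]
    gcongr
    exact hC n
  have hlim2 : Tendsto (fun n => ∫ s in (0 : ℝ)..t,
      ⟪H.expI (t - s) φ, approxCommutator H A (τ n) (H.expI (-s) ψ)⟫_ℂ) atTop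
      (𝓝 (⟪A ⟨_, hφ⟩, H.expI (-t) (R ψ)⟫_ℂ - ⟪H.expI t (R φ), A ⟨_, hψ⟩⟫_ℂ)) := by
    have h1 := (((tendsto_diffQuotient hA ⟨_, hφ⟩).comp tendsto_neg_punctured).comp hτ).inner
      (𝕜 := ℂ) (tendsto_const_nhds (x := H.expI (-t) (R ψ)))
    have h2 := (tendsto_const_nhds (x := H.expI t (R φ))).inner (𝕜 := ℂ)
      ((tendsto_diffQuotient hA ⟨_, hψ⟩).comp hτ)
    refine (h1.sub h2).congr fun n => ?_
    rw [integral_inner_approxCommutator hH, ← inner_diffQuotient A (τ n) (R φ)]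
    rfl
  rw [tendsto_nhds_unique hlim hlim2]
  refine (norm_sub_le _ _).trans (add_le_add ?_ ?_)
  · refine (norm_inner_le_norm _ _).trans ?_
    rw [norm_expI_apply]
  · refine (norm_inner_le_norm _ _).trans ?_
    rw [norm_expI_apply]

end Commutator

end LinearPMap

/-! ### Weak decay, reduction and absence of eigenvectors. -/

namespace LinearPMap

variable {𝓗 : Type*} [NormedAddCommGroup 𝓗] [InnerProductSpace ℂ 𝓗] [CompleteSpace 𝓗]
  {H A : 𝓗 →ₗ.[ℂ] 𝓗}

theorem tendsto_zero_of_mem_closure {u : ℝ → 𝓗 → ℂ} {C : ℝ}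
    (hu : ∀ t x y, ‖u t x - u t y‖ ≤ C * ‖x - y‖) {S : Set 𝓗}
    (hS : ∀ x ∈ S, Tendsto (fun t => u t x) atTop (𝓝 0)) {x : 𝓗} (hx : x ∈ _root_.closure S) :
    Tendsto (fun t => u t x) atTop (𝓝 0) := by
  rw [Metric.tendsto_nhds]
  intro ε hε
  -- Using |C| + 1 avoids any sign condition on C and division by zero.
  obtain ⟨y, hy, hxy⟩ := Metric.mem_closure_iff.1 hx (ε / 2 / (|C| + 1)) (by positivity)
  filter_upwards [Metric.tendsto_nhds.1 (hS y hy) (ε / 2) (half_pos hε)] with t ht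
  rw [dist_zero_right] at ht ⊢
  rw [dist_eq_norm, lt_div_iff₀ (by positivity)] at hxy
  have h1 : ‖u t x - u t y‖ < ε / 2 := by
    refine (hu t x y).trans_lt (lt_of_le_of_lt ?_ hxy)
    rw [mul_comm]
    gcongr
    exact (le_abs_self C).trans (by linarith)
  calc ‖u t x‖ = ‖(u t x - u t y) + u t y‖ := by rw [sub_add_cancel]
    _ ≤ ‖u t x - u t y‖ + ‖u t y‖ := norm_add_le _ _
    _ < ε := by linarith

theorem tendsto_inner_expI_of_mem_closure_right {φ : 𝓗} {S : Set 𝓗}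
    (hS : ∀ χ ∈ S, Tendsto (fun t : ℝ => ⟪φ, H.expI (-t) χ⟫_ℂ) atTop (𝓝 0)) {χ : 𝓗}
    (hχ : χ ∈ _root_.closure S) : Tendsto (fun t : ℝ => ⟪φ, H.expI (-t) χ⟫_ℂ) atTop (𝓝 0) := by
  refine tendsto_zero_of_mem_closure (C := ‖φ‖) (fun t x y => ?_) hS hχ
  rw [← inner_sub_right, ← _root_.map_sub, ← norm_expI_apply H (-t) (x - y)]
  exact norm_inner_le_norm _ _

theorem tendsto_inner_expI_of_mem_closure_left {χ : 𝓗} {S : Set 𝓗}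
    (hS : ∀ φ ∈ S, Tendsto (fun t : ℝ => ⟪φ, H.expI (-t) χ⟫_ℂ) atTop (𝓝 0)) {φ : 𝓗}
    (hφ : φ ∈ _root_.closure S) : Tendsto (fun t : ℝ => ⟪φ, H.expI (-t) χ⟫_ℂ) atTop (𝓝 0) := by
  refine tendsto_zero_of_mem_closure (u := fun t φ => ⟪φ, H.expI (-t) χ⟫_ℂ) (C := ‖χ‖)
    (fun t x y => ?_) hS hφ
  rw [← inner_sub_left, ← norm_expI_apply H (-t) χ, mul_comm]
  exact norm_inner_le_norm _ _

/-- Weak decay of the evolution on the closure of the range of the strong limit of the time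
averages of the commutator. -/
theorem tendsto_inner_expI_of_mem_closure_range (hH : IsSelfAdjoint H) (hA : IsSelfAdjoint A)
    (hHA : A.IsOfClass 1 (H.resolventAt Complex.I)) {D : 𝓗 →L[ℂ] 𝓗}
    (hD : ∀ ψ : 𝓗, Tendsto (fun t : ℝ => H.timeAverage (H.sandwichedCommutator A) t ψ) atTop
      (𝓝 (D ψ))) (φ : 𝓗) {χ : 𝓗} (hχ : χ ∈ _root_.closure (Set.range D)) :
    Tendsto (fun t : ℝ => ⟪φ, H.expI (-t) χ⟫_ℂ) atTop (𝓝 0) := by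
  have hdense : _root_.closure (Set.range D) ⊆ _root_.closure (D '' A.domain) := by
    refine closure_minimal ?_ isClosed_closure
    rintro _ ⟨ψ, rfl⟩
    exact image_closure_subset_closure_image D.continuous ⟨ψ, hA.dense_domain ψ, rfl⟩
  refine tendsto_inner_expI_of_mem_closure_right (S := D '' A.domain) ?_ (hdense hχ)
  rintro _ ⟨ψ, hψ, rfl⟩
  refine tendsto_inner_expI_of_mem_closure_left (S := A.domain) (fun φ hφ => ?_)
    (hA.dense_domain φ)
  obtain ⟨c, hc⟩ := exists_norm_inner_integral_le hH hA hHA ⟨φ, hφ⟩ ⟨ψ, hψ⟩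
  have hlim : Tendsto (fun t : ℝ => ‖φ‖ * ‖D ψ - H.timeAverage (H.sandwichedCommutator A) t ψ‖ +
      |t⁻¹| * c) atTop (𝓝 0) := by
    have h1 : Tendsto (fun t : ℝ => |t⁻¹|) atTop (𝓝 0) := by
      have := (tendsto_inv_atTop_zero (𝕜 := ℝ)).abs
      rwa [abs_zero] at this
    have h2 := (tendsto_const_nhds (x := D ψ)).sub (hD ψ)
    have h3 := (h2.norm.const_mul ‖φ‖).add (h1.mul_const c)
    simpa using h3
  refine squeeze_zero_norm (fun t => ?_) hlim
  -- The first term is controlled by ‖φ‖ times the strong convergence error, the second by the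
  -- uniform bound divided by t.
  have e : ⟪φ, H.expI (-t) (D ψ)⟫_ℂ =
      ⟪H.expI t φ, D ψ - H.timeAverage (H.sandwichedCommutator A) t ψ⟫_ℂ +
      ⟪H.expI t φ, H.timeAverage (H.sandwichedCommutator A) t ψ⟫_ℂ := by
    rw [← inner_expI_left, inner_sub_right, sub_add_cancel]
  rw [e]
  refine (norm_add_le _ _).trans (add_le_add ?_ ?_)
  · refine (norm_inner_le_norm _ _).trans ?_
    rw [norm_expI_apply]
  · rw [timeAverage, ← Complex.coe_smul, inner_smul_right, norm_mul, Complex.norm_real,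
      Real.norm_eq_abs]
    gcongr
    exact hc t

/-- The indicator of {|g| > 1/(n+1)} is g times the bounded function 1/g cut off there, and these
indicators converge to that of {g ≠ 0}. -/
theorem spectralProjection_apply_mem_closure_range (H : 𝓗 →ₗ.[ℂ] 𝓗) {g : ℝ → ℝ}
    (hg : BddMeas fun x => (g x : ℂ)) (hgm : Measurable g) (η : 𝓗) :
    H.spectralProjection (g ⁻¹' {0})ᶜ η ∈
      _root_.closure (Set.range (H.borelCalculus fun x => (g x : ℂ))) := by
  have hμ := H.spectralMeasure.isSpectralFamily
  have hs : ∀ n : ℕ, MeasurableSet {x | 1 / ((n : ℝ) + 1) < |g x|} := fun n =>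
    measurableSet_lt measurable_const hgm.abs
  have hΛ : MeasurableSet (g ⁻¹' {0})ᶜ := (hgm (measurableSet_singleton 0)).compl
  let f : ℕ → ℝ → ℂ := fun n => {x | 1 / ((n : ℝ) + 1) < |g x|}.indicator fun x => (g x : ℂ)⁻¹
  have hf : ∀ n, BddMeas (f n) := fun n => by
    refine ⟨hg.measurable.inv.indicator (hs n), (n : ℝ) + 1, fun x => ?_⟩
    by_cases hx : x ∈ {x | 1 / ((n : ℝ) + 1) < |g x|}
    · rw [show f n x = (g x : ℂ)⁻¹ from Set.indicator_of_mem hx _, norm_inv, Complex.norm_real,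
        Real.norm_eq_abs]
      exact inv_le_of_inv_le₀ (by positivity) (by rw [← one_div]; exact le_of_lt hx)
    · rw [show f n x = 0 from Set.indicator_of_notMem hx _, norm_zero]
      positivity
  have key := hμ.tendsto_op (l := atTop) (C := 1) (fun n => .indicator_one (hs n))
    (.indicator_one hΛ) (Eventually.of_forall fun n x => by
      by_cases hx : x ∈ {x | 1 / ((n : ℝ) + 1) < |g x|}
      · rw [Set.indicator_of_mem hx]; simp
      · rw [Set.indicator_of_notMem hx]; simp) (fun x => ?_) η
  · refine mem_closure_of_tendsto key (Eventually.of_forall fun n => ?_)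
    refine ⟨H.borelCalculus (f n) η, ?_⟩
    rw [borelCalculus_eq_opIntegral, borelCalculus_eq_opIntegral, hμ.op_mul_apply hg (hf n)]
    congr 2
    ext x
    by_cases hx : x ∈ {x | 1 / ((n : ℝ) + 1) < |g x|}
    · have hgx : (g x : ℂ) ≠ 0 := by
        have h1 : 0 < |g x| := lt_trans (by positivity) (show 1 / ((n : ℝ) + 1) < |g x| from hx)
        exact_mod_cast abs_pos.1 h1
      rw [show f n x = (g x : ℂ)⁻¹ from Set.indicator_of_mem hx _, Set.indicator_of_mem hx,
        mul_inv_cancel₀ hgx]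
    · rw [show f n x = 0 from Set.indicator_of_notMem hx _, Set.indicator_of_notMem hx, mul_zero]
  · by_cases hx : g x = 0
    · refine tendsto_const_nhds.congr fun n => ?_
      rw [Set.indicator_of_notMem (by simpa using hx), Set.indicator_of_notMem]
      have : (0 : ℝ) ≤ 1 / ((n : ℝ) + 1) := by positivity
      simpa [hx] using this
    · refine tendsto_const_nhds.congr' ?_
      filter_upwards [tendsto_one_div_add_atTop_nhds_zero_nat.eventually_lt_const
        (abs_pos.2 hx)] with n hn
      rw [Set.indicator_of_mem (show x ∈ (g ⁻¹' {0})ᶜ from hx), Set.indicator_of_mem]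
      exact hn

theorem isStarProjection_spectralProjection (H : 𝓗 →ₗ.[ℂ] 𝓗) {S : Set ℝ} (hS : MeasurableSet S) :
    IsStarProjection (H.spectralProjection S) := by
  have e : H.spectralProjection S = H.spectralMeasure.proj S :=
    H.spectralMeasure.isSpectralFamily.op_eq (H.spectralMeasure.isIntegralOf_indicator hS)
  rw [e]
  exact H.spectralMeasure.isStarProjection S hS

/-- The projection P commutes with R, so Px = RP(H - i)x lies in dom(H) and HPx = PHx. -/
theorem isReducedBy_range_spectralProjection (hH : IsSelfAdjoint H) {S : Set ℝ}
    (hS : MeasurableSet S) : H.IsReducedBy (H.spectralProjection S).range := by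
  have hR := isResolventAt_resolventAt hH
  have hP := isStarProjection_spectralProjection H hS
  set P := H.spectralProjection S
  have hPP : ∀ x, P (P x) = P x := fun x =>
    congrArg (fun T : 𝓗 →L[ℂ] 𝓗 => T x) hP.isIdempotentElem
  have hPa : ContinuousLinearMap.adjoint P = P := hP.isSelfAdjoint
  have hort : ∀ x, x - P x ∈ P.rangeᗮ := fun x => by
    rw [Submodule.mem_orthogonal]
    rintro _ ⟨u, rfl⟩
    change ⟪P u, x - P x⟫_ℂ = 0
    rw [← hPa, ContinuousLinearMap.adjoint_inner_left, hPa, _root_.map_sub, hPP, sub_self,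
      inner_zero_right]
  refine ⟨?_, fun x => ?_⟩
  · have e : (P.range : Set 𝓗) = {x | P x = x} := by
      ext x
      exact ⟨by rintro ⟨u, rfl⟩; exact hPP u, fun h => ⟨x, h⟩⟩
    rw [e]
    exact isClosed_eq P.continuous continuous_id
  · have hcomm : ∀ η, P (H.resolventAt Complex.I η) = H.resolventAt Complex.I (P η) := fun η => by
      rw [← opIntegral_sub_I_inv hH hR]
      exact H.spectralMeasure.isSpectralFamily.op_comm (.indicator_one hS) bddMeas_sub_I_inv η
    have hx := hR.2 x
    obtain ⟨hd, he⟩ := hR.apply_eq (P (H x - Complex.I • (x : 𝓗)))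
    have hPx : H.resolventAt Complex.I (P (H x - Complex.I • (x : 𝓗))) = P x := by
      rw [← hcomm, hx]
    have hy : ∃ h : P x ∈ H.domain, H ⟨P x, h⟩ = P (H x) := by
      rw [← hPx]
      refine ⟨hd, he.trans ?_⟩
      rw [hPx, _root_.map_sub, _root_.map_smul, sub_add_cancel]
    obtain ⟨hd, he⟩ := hy
    refine ⟨⟨P x, hd⟩, x - ⟨P x, hd⟩, by simp, ⟨x, rfl⟩, hort x, ?_, ?_⟩
    · rw [he]; exact ⟨H x, rfl⟩
    · rw [LinearPMap.map_sub, he]; exact hort _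

theorem expI_apply_of_eigenvector (hH : IsSelfAdjoint H) {x : H.domain} {a : ℝ}
    (hx : H x = (a : ℂ) • (x : 𝓗)) (t : ℝ) :
    H.expI t (x : 𝓗) = Complex.exp (Complex.I * a * t) • (x : 𝓗) := by
  -- The curve e^{-ias}e^{isH}x has zero derivative, so it stays at x.
  have hd : ∀ s : ℝ, HasDerivAt (fun s : ℝ => Complex.exp (-(Complex.I * a * s)) •
      H.expI s (x : 𝓗)) 0 s := fun s => by
    have h1 : HasDerivAt (fun s : ℝ => -(Complex.I * a * (s : ℂ))) (-(Complex.I * a * 1)) s :=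
      ((Complex.ofRealCLM.hasDerivAt (x := s)).const_mul (Complex.I * a)).neg
    refine (h1.cexp.smul (hasDerivAt_expI hH s x)).congr_deriv ?_
    rw [hx, _root_.map_smul, smul_smul, smul_smul, ← add_smul]
    convert zero_smul ℂ _
    ring
  have h := is_const_of_deriv_eq_zero (fun s => (hd s).differentiableAt) (fun s => (hd s).deriv) t 0
  simp only [Complex.ofReal_zero, mul_zero, neg_zero, Complex.exp_zero, expI_zero, one_smul,
    one_apply_eq_self] at h
  have h2 := congrArg (fun y => Complex.exp (Complex.I * a * t) • y) h
  simp only [smul_smul, ← Complex.exp_add, add_neg_cancel, Complex.exp_zero, one_smul] at h2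
  exact h2

/-- For x ≠ 0 symmetry makes the eigenvalue real, so e^{-itH} only rotates x by a phase and |⟨x,
e^{-itH}x⟩| = ‖x‖² cannot decay. -/
theorem eq_zero_of_eigenvector_of_tendsto (hH : IsSelfAdjoint H) {x : H.domain} {a : ℂ}
    (hx : H x = a • (x : 𝓗))
    (hlim : Tendsto (fun t : ℝ => ⟪(x : 𝓗), H.expI (-t) x⟫_ℂ) atTop (𝓝 0)) : (x : 𝓗) = 0 := by
  by_contra h0
  have h1 := inner_apply_comm_of_isSelfAdjoint hH x x
  rw [hx, inner_smul_left, inner_smul_right] at h1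
  have ha : starRingEnd ℂ a = a := mul_right_cancel₀ (inner_self_ne_zero.2 h0) h1
  obtain ⟨b, rfl⟩ : ∃ b : ℝ, a = b := ⟨a.re, (Complex.conj_eq_iff_re.1 ha).symm⟩
  have h2 : ∀ t : ℝ, ‖⟪(x : 𝓗), H.expI (-t) x⟫_ℂ‖ = ‖(x : 𝓗)‖ ^ 2 := fun t => by
    have e : Complex.I * b * ((-t : ℝ) : ℂ) = ((b * -t : ℝ) : ℂ) * Complex.I := by
      push_cast; ring
    rw [expI_apply_of_eigenvector hH hx, inner_smul_right, norm_mul, e,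
      Complex.norm_exp_ofReal_mul_I, one_mul, inner_self_eq_norm_sq_to_K]
    simp
  have h3 := hlim.norm
  simp only [h2, norm_zero] at h3
  have h4 := tendsto_nhds_unique h3 tendsto_const_nhds
  exact h0 (norm_eq_zero.1 (pow_eq_zero_iff two_ne_zero |>.1 h4.symm))

theorem hasPurelyContinuousSpectrum_partIn (hH : IsSelfAdjoint H) {K : Submodule ℂ 𝓗}
    (hK : ∀ φ : 𝓗, ∀ ψ ∈ K, Tendsto (fun t : ℝ => ⟪φ, H.expI (-t) ψ⟫_ℂ) atTop (𝓝 0)) :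
    (H.partIn K).HasPurelyContinuousSpectrum := by
  have hspan : Submodule.span ℂ {x : K | ∃ (h : x ∈ (H.partIn K).domain) (a : ℂ),
      H.partIn K ⟨x, h⟩ = a • x} = ⊥ := by
    rw [Submodule.span_eq_bot]
    rintro x ⟨h, a, hx⟩
    have hx' : H ⟨(x : 𝓗), h.choose⟩ = a • (x : 𝓗) := congrArg Subtype.val hx
    exact Subtype.ext (eq_zero_of_eigenvector_of_tendsto hH hx' (hK x x x.2))
  rw [HasPurelyContinuousSpectrum, pointSubspace, hspan]
  exact (Submodule.closed_of_finiteDimensional ⊥).submodule_topologicalClosure_eq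

end LinearPMap

theorem corollary4p3 {𝓗 : Type*} [NormedAddCommGroup 𝓗] [InnerProductSpace ℂ 𝓗] [CompleteSpace 𝓗]
    (H A : 𝓗 →ₗ.[ℂ] 𝓗) (hH : IsSelfAdjoint H) (hA : IsSelfAdjoint A)
    (hHA : A.IsOfClass 1 (H.resolventAt Complex.I))
    (D : 𝓗 →L[ℂ] 𝓗)
    (hD : ∀ ψ : 𝓗, Tendsto (fun t : ℝ => H.timeAverage (H.sandwichedCommutator A) t ψ) atTop
      (𝓝 (D ψ)))
    (g : ℝ → ℝ) (hg : ContDiff ℝ 2 g) (hgb : ∃ C : ℝ, ∀ x, |g x| ≤ C)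
    (hDg : D = H.borelCalculus fun x => (g x : ℂ)) :
    (∀ φ : 𝓗, ∀ ψ ∈ (H.spectralProjection (g ⁻¹' {0})ᶜ).range,
      Tendsto (fun t : ℝ => ⟪φ, H.expI (-t) ψ⟫_ℂ) atTop (𝓝 0)) ∧
    H.IsReducedBy (H.spectralProjection (g ⁻¹' {0})ᶜ).range ∧
    (H.partIn (H.spectralProjection (g ⁻¹' {0})ᶜ).range).HasPurelyContinuousSpectrum := by
  have hgm : Measurable g := hg.continuous.measurable
  have hgB : BddMeas fun x => (g x : ℂ) := by
    obtain ⟨C, hC⟩ := hgb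
    exact ⟨Complex.measurable_ofReal.comp hgm, C, fun x => by simpa using hC x⟩
  have hdecay : ∀ φ : 𝓗, ∀ ψ ∈ (H.spectralProjection (g ⁻¹' {0})ᶜ).range,
      Tendsto (fun t : ℝ => ⟪φ, H.expI (-t) ψ⟫_ℂ) atTop (𝓝 0) := by
    rintro φ _ ⟨η, rfl⟩
    refine LinearPMap.tendsto_inner_expI_of_mem_closure_range hH hA hHA hD φ ?_
    rw [hDg]
    exact LinearPMap.spectralProjection_apply_mem_closure_range H hgB hgm η
  exact ⟨hdecay, LinearPMap.isReducedBy_range_spectralProjection hH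
    (hgm (measurableSet_singleton 0)).compl,
    LinearPMap.hasPurelyContinuousSpectrum_partIn hH hdecay⟩
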